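/- **Setting.** Let $d\in\{2,3\}$ and let $\Omega\subset\mathbb R^d$ be a bounded simply connected Lipschitz domain. Let $0=t_0<t_1<\dots<t_N$ be time steps and $k_n:=t_n-t_{n-1}$. For each $n$ let $\mathcal T_n$ be a mesh of $\Omega$: a finite family of pairwise disjoint open subsets $K\subset\Omega$ with Lipschitz boundary that cover $\Omega$ up to a null set (no conformity or shape regularity is needed). $(\cdot,\cdot)$ and $\|\cdot\|$ denote the inner product and norm of $L^2(\Omega)$ and of $L^2(\Omega)^d$. *Function spaces.* $H^1(\mathcal T_n)$ and $H(\mathrm{div},\mathcal T_n)$ are the spaces of $v\in L^2(\Omega)$, resp. $\tau\in L^2(\Omega)^d$, whose restrictions to every $K\in\mathcal T_n$ lie in $H^1(K)$, resp. $H(\mathrm{div},K)$; $\nabla v$ and $\mathrm{div}\,\tau$ denote their piecewise weak derivatives. $H^{1/2}(\partial K)$ is the trace space of $H^1(K)$ (that is, $H^1(K)/H^1_0(K)$), $H^{-1/2}(\partial K)$ is its dual, and the normal trace $(q\cdot n_K)|_{\partial K}\in H^{-1/2}(\partial K)$ of $q\in H(\mathrm{div},K)$ is given by $\langle q\cdot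 n_K,w|_{\partial K}\rangle_{\partial K}=(q,\nabla w)_K+(\mathrm{div}\,q,w)_K$ for $w\in H^1(K)$. Set $$H^{1/2}_{00}(\mathcal S_n)=\{(w|_{\partial K})_{K\in\mathcal T_n}: w\in H^1_0(\Omega)\},\qquad H^{-1/2}(\mathcal S_n)=\{((q\cdot n_K)|_{\partial K})_{K\in\mathcal T_n}: q\in H(\mathrm{div},\Omega)\},$$ $$X^n=L^2(\Omega)\times L^2(\Omega)^d\times H^{1/2}_{00}(\mathcal S_n)\times H^{-1/2}(\mathcal S_n),\qquad Y^n=H^1(\mathcal T_n)\times H(\mathrm{div},\mathcal T_n).$$ *Forms.* For $\boldsymbol u=(u,\sigma,\hat u,\hat\sigma)\in X^n$ and $\boldsymbol v=(v,\tau)\in Y^n$ let $$b_e^n(\boldsymbol u,\boldsymbol v)=\tfrac1{k_n}(u,v)+(u,\mathrm{div}\,\tau)+(\sigma,\nabla v+\tau)-\sum_{K\in\mathcal T_n}\langle\tau\cdot n_K,\hat u\rangle_{\partial K}-\sum_{K\in\mathcal T_n}\langle v,\hat\sigma\rangle_{\partial K}.$$ Let $\langle\!\langle\cdot,\cdot\rangle\!\rangle_{Y^n}$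 be the inner product on $Y^n$ with norm $$\|\boldsymbol v\|_{Y^n}^2=\tfrac1{k_n^2}\|v\|^2+\tfrac1{k_n}\|\nabla v\|^2+\tfrac1{k_n}\|\tau\|^2+\|\mathrm{div}\,\tau\|^2,$$ and define the optimal test function $\Theta^n\boldsymbol u\in Y^n$ of $\boldsymbol u\in X^n$ by $\langle\!\langle\Theta^n\boldsymbol u,\boldsymbol v\rangle\!\rangle_{Y^n}=b_e^n(\boldsymbol u,\boldsymbol v)$ for all $\boldsymbol v\in Y^n$. *Scheme.* Let $u_0\in L^2(\Omega)$, let $f(t)\in L^2(\Omega)$ for every $t$, and put $f^n:=f(t_n)$. Let $X_h^0\subset L^2(\Omega)$ and $X_h^n\subset X^n$ ($n=1,\dots,N$) be arbitrary finite-dimensional subspaces. The fully discrete DPG scheme is: find $u_h^0\in X_h^0$ and $\boldsymbol u_h^n=(u_h^n,\sigma_h^n,\hat u_h^n,\hat\sigma_h^n)\in X_h^n$ ($n=1,\dots,N$) such that $$(u_h^0,v)=(u_0,v)\quad\forall v\in X_h^0,\qquad b_e^n(\boldsymbol u_h^n,\boldsymbol v)=\bigl(f^n+\tfrac1{k_n}u_h^{n-1},v\bigr)\quad\forall\,\boldsymbol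 v=(v,\tau)\in\Theta^nX_h^n,\ n=1,\dots,N.$$ **Theorem 2.3.** The scheme has exactly one solution. It satisfies $$\bigl(\|u_h^n\|^2+k_n\|\sigma_h^n\|^2\bigr)^{1/2}\le\|u_h^{n-1}\|+k_n\|f^n\|\qquad(n=1,\dots,N)$$ and, if $N\ge1$, $$\bigl(\|u_h^N\|^2+k_N\|\sigma_h^N\|^2\bigr)^{1/2}\le\|u_0\|+\sum_{n=1}^Nk_n\|f^n\|.$$ -/

import Mathlib

open MeasureTheory
open scoped ContDiff InnerProductSpace

namespace DPG

noncomputable section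

/-! ## Lebesgue spaces and weak derivatives -/

/-- The Euclidean space `ℝ^d`. -/
abbrev Space (d : ℕ) := EuclideanSpace ℝ (Fin d)

/-- `L²(U)`. -/
abbrev L2 {d : ℕ} (U : Set (Space d)) := Lp ℝ 2 (volume.restrict U)

/-- The space `L²(U)^d` of square integrable vector fields. -/
abbrev L2v {d : ℕ} (U : Set (Space d)) := Lp (Space d) 2 (volume.restrict U)

/-- `φ ∈ C_c^∞(U)`. -/
structure IsTestFun {d : ℕ} (U : Set (Space d)) (φ : Space d → ℝ) : Prop where
  smooth : ContDiff ℝ ∞ φ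
  compact : HasCompactSupport φ
  supp : tsupport φ ⊆ U

/-- `g` is the weak gradient of `v` in `U`. -/
def HasWeakGrad {d : ℕ} (U : Set (Space d)) (v : Space d → ℝ) (g : Space d → Space d) : Prop :=
  ∀ φ : Space d → ℝ, IsTestFun U φ →
    ∫ x in U, v x • gradient φ x = -∫ x in U, φ x • g x

/-- `δ` is the weak divergence of `τ` in `U`. -/
def HasWeakDiv {d : ℕ} (U : Set (Space d)) (τ : Space d → Space d) (δ : Space d → ℝ) : Prop :=
  ∀ φ : Space d → ℝ, IsTestFun U φ →
    ∫ x in U, ⟪τ x, gradient φ x⟫_ℝ = -∫ x in U, ⟪δ x, φ x⟫_ℝ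

section Helpers

variable {d : ℕ} {U K : Set (Space d)}

theorem IsTestFun.memLp {φ : Space d → ℝ} (h : IsTestFun U φ) :
    MemLp φ 2 (volume.restrict U) :=
  (h.smooth.continuous.memLp_of_hasCompactSupport h.compact).restrict U

theorem IsTestFun.gradient_eq {φ : Space d → ℝ} :
    gradient φ = fun x => (InnerProductSpace.toDual ℝ (Space d)).symm (fderiv ℝ φ x) := rfl

theorem IsTestFun.memLp_gradient {φ : Space d → ℝ} (h : IsTestFun U φ) :
    MemLp (gradient φ) 2 (volume.restrict U) := by
  have hc : Continuous (gradient φ) := by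
    rw [IsTestFun.gradient_eq]
    exact (LinearIsometryEquiv.continuous _).comp (h.smooth.continuous_fderiv (by simp))
  have hs : HasCompactSupport (gradient φ) := by
    rw [IsTestFun.gradient_eq]
    exact (h.compact.fderiv (𝕜 := ℝ)).comp_left
      (g := fun L => (InnerProductSpace.toDual ℝ (Space d)).symm L) (by simp)
  exact (hc.memLp_of_hasCompactSupport hs).restrict U

theorem integrable_smul_two {μ : Measure (Space d)} {f : Space d → ℝ} {g : Space d → Space d}
    (hf : MemLp f 2 μ) (hg : MemLp g 2 μ) : Integrable (fun x => f x • g x) μ :=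
  memLp_one_iff_integrable.1 (hg.smul (r := 1) hf)

theorem integrable_inner_two {F : Type*} [NormedAddCommGroup F] [InnerProductSpace ℝ F]
    {μ : Measure (Space d)} {f g : Space d → F}
    (hf : MemLp f 2 μ) (hg : MemLp g 2 μ) : Integrable (fun x => ⟪f x, g x⟫_ℝ) μ :=
  (memLp_one_iff_integrable.1 (hg.norm.mul (r := 1) hf.norm)).mono
    (hf.1.inner hg.1)
    (Filter.Eventually.of_forall fun x => by
      simpa using norm_inner_le_norm (𝕜 := ℝ) (f x) (g x))

theorem HasWeakGrad.congr {v v' : Space d → ℝ} {g g' : Space d → Space d}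
    (h : HasWeakGrad U v g) (hv : v' =ᵐ[volume.restrict U] v)
    (hg : g' =ᵐ[volume.restrict U] g) : HasWeakGrad U v' g' := by
  intro φ hφ
  have h1 : ∫ x in U, v' x • gradient φ x = ∫ x in U, v x • gradient φ x :=
    integral_congr_ae (by filter_upwards [hv] with x hx; rw [hx])
  have h2 : ∫ x in U, φ x • g' x = ∫ x in U, φ x • g x :=
    integral_congr_ae (by filter_upwards [hg] with x hx; rw [hx])
  rw [h1, h2]; exact h φ hφ

theorem HasWeakDiv.congr {v v' : Space d → Space d} {g g' : Space d → ℝ}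
    (h : HasWeakDiv U v g) (hv : v' =ᵐ[volume.restrict U] v)
    (hg : g' =ᵐ[volume.restrict U] g) : HasWeakDiv U v' g' := by
  intro φ hφ
  have h1 : ∫ x in U, ⟪v' x, gradient φ x⟫_ℝ = ∫ x in U, ⟪v x, gradient φ x⟫_ℝ :=
    integral_congr_ae (by filter_upwards [hv] with x hx; rw [hx])
  have h2 : ∫ x in U, ⟪g' x, φ x⟫_ℝ = ∫ x in U, ⟪g x, φ x⟫_ℝ :=
    integral_congr_ae (by filter_upwards [hg] with x hx; rw [hx])
  rw [h1, h2]; exact h φ hφ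

theorem HasWeakGrad.zero : HasWeakGrad U (fun _ => 0) (fun _ => 0) := by
  intro φ _; simp

theorem HasWeakDiv.zero : HasWeakDiv U (fun _ => 0) (fun _ => 0) := by
  intro φ _; simp

theorem HasWeakGrad.add {v v' : Space d → ℝ} {g g' : Space d → Space d}
    (h : HasWeakGrad U v g) (h' : HasWeakGrad U v' g')
    (hv : MemLp v 2 (volume.restrict U)) (hv' : MemLp v' 2 (volume.restrict U))
    (hg : MemLp g 2 (volume.restrict U)) (hg' : MemLp g' 2 (volume.restrict U)) :
    HasWeakGrad U (v + v') (g + g') := by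
  intro φ hφ
  simp only [Pi.add_apply, add_smul, smul_add]
  rw [integral_add (integrable_smul_two hv hφ.memLp_gradient)
      (integrable_smul_two hv' hφ.memLp_gradient),
    integral_add (integrable_smul_two hφ.memLp hg) (integrable_smul_two hφ.memLp hg'),
    h φ hφ, h' φ hφ, neg_add]

theorem HasWeakDiv.add {v v' : Space d → Space d} {g g' : Space d → ℝ}
    (h : HasWeakDiv U v g) (h' : HasWeakDiv U v' g')
    (hv : MemLp v 2 (volume.restrict U)) (hv' : MemLp v' 2 (volume.restrict U))
    (hg : MemLp g 2 (volume.restrict U)) (hg' : MemLp g' 2 (volume.restrict U)) :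
    HasWeakDiv U (v + v') (g + g') := by
  intro φ hφ
  simp only [Pi.add_apply, inner_add_left]
  rw [integral_add (integrable_inner_two hv hφ.memLp_gradient)
      (integrable_inner_two hv' hφ.memLp_gradient),
    integral_add (integrable_inner_two hg hφ.memLp) (integrable_inner_two hg' hφ.memLp),
    h φ hφ, h' φ hφ, neg_add]

theorem HasWeakGrad.smul {v : Space d → ℝ} {g : Space d → Space d}
    (h : HasWeakGrad U v g) (c : ℝ) : HasWeakGrad U (c • v) (c • g) := by
  intro φ hφ
  simp only [Pi.smul_apply, smul_assoc, smul_comm _ c]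
  rw [integral_smul, integral_smul, h φ hφ, smul_neg]

theorem HasWeakDiv.smul {v : Space d → Space d} {g : Space d → ℝ}
    (h : HasWeakDiv U v g) (c : ℝ) : HasWeakDiv U (c • v) (c • g) := by
  intro φ hφ
  simp only [Pi.smul_apply, real_inner_smul_left]
  rw [integral_const_mul, integral_const_mul, h φ hφ, mul_neg]

theorem IsTestFun.mono {φ : Space d → ℝ} (h : IsTestFun K φ) (hKU : K ⊆ U) : IsTestFun U φ :=
  ⟨h.smooth, h.compact, h.supp.trans hKU⟩

theorem IsTestFun.eq_zero {φ : Space d → ℝ} (h : IsTestFun K φ) {x : Space d} (hx : x ∉ K) :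
    φ x = 0 := image_eq_zero_of_notMem_tsupport fun hx' => hx (h.supp hx')

theorem IsTestFun.gradient_eq_zero {φ : Space d → ℝ} (h : IsTestFun K φ) {x : Space d}
    (hx : x ∉ K) : gradient φ x = 0 := by
  have : fderiv ℝ φ x = 0 := by
    by_contra hne
    exact hx (h.supp (support_fderiv_subset ℝ hne))
  rw [IsTestFun.gradient_eq]
  simp [this]

theorem HasWeakGrad.mono {v : Space d → ℝ} {g : Space d → Space d} (h : HasWeakGrad U v g)
    (hU : MeasurableSet U) (hKU : K ⊆ U) : HasWeakGrad K v g := by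
  intro φ hφ
  rw [← setIntegral_eq_of_subset_of_forall_sdiff_eq_zero hU hKU
      (fun x hx => by rw [hφ.gradient_eq_zero hx.2, smul_zero]),
    ← setIntegral_eq_of_subset_of_forall_sdiff_eq_zero hU hKU
      (fun x hx => by rw [hφ.eq_zero hx.2, zero_smul])]
  exact h φ (hφ.mono hKU)

theorem HasWeakDiv.mono {v : Space d → Space d} {g : Space d → ℝ} (h : HasWeakDiv U v g)
    (hU : MeasurableSet U) (hKU : K ⊆ U) : HasWeakDiv K v g := by
  intro φ hφ
  rw [← setIntegral_eq_of_subset_of_forall_sdiff_eq_zero hU hKU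
      (fun x hx => by rw [hφ.gradient_eq_zero hx.2, inner_zero_right]),
    ← setIntegral_eq_of_subset_of_forall_sdiff_eq_zero hU hKU
      (fun x hx => by rw [hφ.eq_zero hx.2, inner_zero_right])]
  exact h φ (hφ.mono hKU)

end Helpers

/-- Restriction `L²(U) → L²(K)` of (scalar or vector valued) functions to a subset `K ⊆ U`. -/
def restrictL2 {d : ℕ} {F : Type*} [NormedAddCommGroup F] [NormedSpace ℝ F]
    {K U : Set (Space d)} (h : K ⊆ U) :
    Lp F 2 (volume.restrict U) →ₗ[ℝ] Lp F 2 (volume.restrict K) where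
  toFun v := ((Lp.memLp v).mono_measure (Measure.restrict_mono h le_rfl)).toLp v
  map_add' v w := by
    rw [← MemLp.toLp_add]
    exact MemLp.toLp_congr _ _ (ae_mono (Measure.restrict_mono h le_rfl) (Lp.coeFn_add v w))
  map_smul' c v := by
    rw [RingHom.id_apply, ← MemLp.toLp_const_smul]
    exact MemLp.toLp_congr _ _ (ae_mono (Measure.restrict_mono h le_rfl) (Lp.coeFn_smul c v))

theorem restrictL2_coe {d : ℕ} {F : Type*} [NormedAddCommGroup F] [NormedSpace ℝ F]
    {K U : Set (Space d)} (h : K ⊆ U) (v : Lp F 2 (volume.restrict U)) :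
    restrictL2 h v =ᵐ[volume.restrict K] v :=
  MemLp.coeFn_toLp ((Lp.memLp v).mono_measure (Measure.restrict_mono h le_rfl))

/-! ## Domains, meshes, Sobolev spaces, broken Sobolev spaces

Elements of `H¹` are represented as pairs `(v, ∇v)`, elements of `H(div)` as pairs `(τ, div τ)`
(the weak derivatives of a given function are unique); they inherit the inner products
`(v, w) + (∇v, ∇w)` and `(τ, ρ) + (div τ, div ρ)` from `L² × L²`. -/

/-- `U` has a Lipschitz boundary: near each of its boundary points, `U` is the region above the
graph of a Lipschitz function, with respect to some direction `e`. The function `g` is applied to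
the projection of `y` onto the hyperplane orthogonal to `e`. -/
def HasLipschitzBoundary {d : ℕ} (U : Set (Space d)) : Prop :=
  ∀ x ∈ frontier U, ∃ e : Space d, ‖e‖ = 1 ∧ ∃ r > 0, ∃ L : NNReal, ∃ g : Space d → ℝ,
    LipschitzWith L g ∧
    ∀ y ∈ Metric.ball x r, (y ∈ U ↔ g (y - ⟪e, y⟫_ℝ • e) < ⟪e, y⟫_ℝ)

/-- A mesh of `Ω`: finitely many pairwise disjoint open sets with Lipschitz boundary which
cover `Ω` up to a null set. As Lipschitz boundaries are null sets, the last condition says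
that the closed elements cover `Ω`. -/
structure Mesh {d : ℕ} (Ω : Set (Space d)) where
  /-- number of elements -/
  card : ℕ
  /-- the elements -/
  elem : Fin card → Set (Space d)
  isOpen : ∀ j, IsOpen (elem j)
  lipschitz : ∀ j, HasLipschitzBoundary (elem j)
  subset : ∀ j, elem j ⊆ Ω
  disjoint : Pairwise fun i j => Disjoint (elem i) (elem j)
  cover : volume (Ω \ ⋃ j, elem j) = 0

/-- Pairs `(v, g) ∈ L²(Ω) × L²(Ω)^d` such that `g` is the weak gradient of `v` in each set
of the family `K`. -/
def familyH1 {d : ℕ} (Ω : Set (Space d)) {ι : Type} (K : ι → Set (Space d))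
    (hK : ∀ j, K j ⊆ Ω) : Submodule ℝ (WithLp 2 (L2 Ω × L2v Ω)) where
  carrier := {p | ∀ j, HasWeakGrad (K j) p.fst p.snd}
  zero_mem' j := HasWeakGrad.zero.congr
    (ae_mono (Measure.restrict_mono (hK j) le_rfl) (Lp.coeFn_zero _ _ _))
    (ae_mono (Measure.restrict_mono (hK j) le_rfl) (Lp.coeFn_zero _ _ _))
  add_mem' {p q} hp hq j :=
    ((hp j).add (hq j)
      ((Lp.memLp p.fst).mono_measure (Measure.restrict_mono (hK j) le_rfl))
      ((Lp.memLp q.fst).mono_measure (Measure.restrict_mono (hK j) le_rfl))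
      ((Lp.memLp p.snd).mono_measure (Measure.restrict_mono (hK j) le_rfl))
      ((Lp.memLp q.snd).mono_measure (Measure.restrict_mono (hK j) le_rfl))).congr
    (ae_mono (Measure.restrict_mono (hK j) le_rfl) (Lp.coeFn_add p.fst q.fst))
    (ae_mono (Measure.restrict_mono (hK j) le_rfl) (Lp.coeFn_add p.snd q.snd))
  smul_mem' c p hp j := ((hp j).smul c).congr
    (ae_mono (Measure.restrict_mono (hK j) le_rfl) (Lp.coeFn_smul c p.fst))
    (ae_mono (Measure.restrict_mono (hK j) le_rfl) (Lp.coeFn_smul c p.snd))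

/-- Pairs `(τ, δ) ∈ L²(Ω)^d × L²(Ω)` such that `δ` is the weak divergence of `τ` in each set
of the family `K`. -/
def familyHdiv {d : ℕ} (Ω : Set (Space d)) {ι : Type} (K : ι → Set (Space d))
    (hK : ∀ j, K j ⊆ Ω) : Submodule ℝ (WithLp 2 (L2v Ω × L2 Ω)) where
  carrier := {p | ∀ j, HasWeakDiv (K j) p.fst p.snd}
  zero_mem' j := HasWeakDiv.zero.congr
    (ae_mono (Measure.restrict_mono (hK j) le_rfl) (Lp.coeFn_zero _ _ _))
    (ae_mono (Measure.restrict_mono (hK j) le_rfl) (Lp.coeFn_zero _ _ _))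
  add_mem' {p q} hp hq j :=
    ((hp j).add (hq j)
      ((Lp.memLp p.fst).mono_measure (Measure.restrict_mono (hK j) le_rfl))
      ((Lp.memLp q.fst).mono_measure (Measure.restrict_mono (hK j) le_rfl))
      ((Lp.memLp p.snd).mono_measure (Measure.restrict_mono (hK j) le_rfl))
      ((Lp.memLp q.snd).mono_measure (Measure.restrict_mono (hK j) le_rfl))).congr
    (ae_mono (Measure.restrict_mono (hK j) le_rfl) (Lp.coeFn_add p.fst q.fst))
    (ae_mono (Measure.restrict_mono (hK j) le_rfl) (Lp.coeFn_add p.snd q.snd))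
  smul_mem' c p hp j := ((hp j).smul c).congr
    (ae_mono (Measure.restrict_mono (hK j) le_rfl) (Lp.coeFn_smul c p.fst))
    (ae_mono (Measure.restrict_mono (hK j) le_rfl) (Lp.coeFn_smul c p.snd))

/-- `H¹(U)`, as the space of pairs `(v, ∇v)`. -/
abbrev H1 {d : ℕ} (U : Set (Space d)) : Submodule ℝ (WithLp 2 (L2 U × L2v U)) :=
  familyH1 U (fun _ : Unit => U) (fun _ => subset_rfl)

/-- `H(div, U)`, as the space of pairs `(τ, div τ)`. -/
abbrev Hdiv {d : ℕ} (U : Set (Space d)) : Submodule ℝ (WithLp 2 (L2v U × L2 U)) :=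
  familyHdiv U (fun _ : Unit => U) (fun _ => subset_rfl)

/-- `H¹(𝒯)`, as the space of pairs `(v, ∇_𝒯 v)`, with the piecewise gradient. -/
abbrev brokenH1 {d : ℕ} {Ω : Set (Space d)} (T : Mesh Ω) :
    Submodule ℝ (WithLp 2 (L2 Ω × L2v Ω)) :=
  familyH1 Ω T.elem T.subset

/-- `H(div, 𝒯)`, as the space of pairs `(τ, div_𝒯 τ)`, with the piecewise divergence. -/
abbrev brokenHdiv {d : ℕ} {Ω : Set (Space d)} (T : Mesh Ω) :
    Submodule ℝ (WithLp 2 (L2v Ω × L2 Ω)) :=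
  familyHdiv Ω T.elem T.subset

/-- `H¹₀(U)`: the closure of `C_c^∞(U)` in `H¹(U)`. -/
def H10 {d : ℕ} (U : Set (Space d)) : Submodule ℝ (H1 U) :=
  (Submodule.span ℝ {w : H1 U | ∃ φ : Space d → ℝ, IsTestFun U φ ∧
    w.1.fst =ᵐ[volume.restrict U] φ ∧
    w.1.snd =ᵐ[volume.restrict U] gradient φ}).topologicalClosure

/-! ## Traces on the boundary of an element -/

/-- Restriction `H¹(𝒯) → H¹(K)` to an element `K` of the mesh. -/
def restrictH1 {d : ℕ} {Ω : Set (Space d)} (T : Mesh Ω) (j : Fin T.card) :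
    brokenH1 T →ₗ[ℝ] H1 (T.elem j) where
  toFun v := ⟨WithLp.toLp 2 (restrictL2 (T.subset j) v.1.fst, restrictL2 (T.subset j) v.1.snd),
    fun _ => (v.2 j).congr (restrictL2_coe _ _) (restrictL2_coe _ _)⟩
  map_add' v w := by ext1; simp [← WithLp.toLp_add]
  map_smul' c v := by ext1; simp [← WithLp.toLp_smul]

/-- Restriction `H(div, 𝒯) → H(div, K)` to an element `K` of the mesh. -/
def restrictHdiv {d : ℕ} {Ω : Set (Space d)} (T : Mesh Ω) (j : Fin T.card) :
    brokenHdiv T →ₗ[ℝ] Hdiv (T.elem j) where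
  toFun v := ⟨WithLp.toLp 2 (restrictL2 (T.subset j) v.1.fst, restrictL2 (T.subset j) v.1.snd),
    fun _ => (v.2 j).congr (restrictL2_coe _ _) (restrictL2_coe _ _)⟩
  map_add' v w := by ext1; simp [← WithLp.toLp_add]
  map_smul' c v := by ext1; simp [← WithLp.toLp_smul]

theorem H1_le_brokenH1 {d : ℕ} {Ω : Set (Space d)} (hΩ : IsOpen Ω) (T : Mesh Ω) :
    H1 Ω ≤ brokenH1 T :=
  fun _ hp j => (hp ()).mono hΩ.measurableSet (T.subset j)

theorem Hdiv_le_brokenHdiv {d : ℕ} {Ω : Set (Space d)} (hΩ : IsOpen Ω) (T : Mesh Ω) :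
    Hdiv Ω ≤ brokenHdiv T :=
  fun _ hp j => (hp ()).mono hΩ.measurableSet (T.subset j)

/-- The trace space `H^{1/2}(∂K)` of `H¹(K)`. Traces are represented modulo the kernel `H¹₀(K)`
of the trace operator, and the norm is the quotient norm, i.e. the minimal extension norm. -/
def Hhalf {d : ℕ} (K : Set (Space d)) : Type := H1 K ⧸ H10 K

theorem isClosed_H10 {d : ℕ} (K : Set (Space d)) : IsClosed (H10 K : Set (H1 K)) :=
  Submodule.isClosed_topologicalClosure _

instance {d : ℕ} (K : Set (Space d)) : NormedAddCommGroup (Hhalf K) :=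
  have : IsClosed (H10 K : Set (H1 K)) := isClosed_H10 K
  inferInstanceAs (NormedAddCommGroup (H1 K ⧸ H10 K))

instance {d : ℕ} (K : Set (Space d)) : NormedSpace ℝ (Hhalf K) :=
  inferInstanceAs (NormedSpace ℝ (H1 K ⧸ H10 K))

/-- `H^{-1/2}(∂K)`, the dual space of `H^{1/2}(∂K)`. -/
abbrev Hmhalf {d : ℕ} (K : Set (Space d)) := StrongDual ℝ (Hhalf K)

/-- The trace `v ↦ v|_{∂K}`. -/
def trace {d : ℕ} (K : Set (Space d)) : H1 K →ₗ[ℝ] Hhalf K := (H10 K).mkQ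

/-- The functional `w ↦ (q, ∇w)_K + (div q, w)_K` on `H¹(K)`. -/
def greenFunctional {d : ℕ} {K : Set (Space d)} (q : Hdiv K) : H1 K →L[ℝ] ℝ :=
  ((innerSL ℝ q.1.fst).comp (WithLp.sndL 2 ℝ (L2 K) (L2v K)) +
    (innerSL ℝ q.1.snd).comp (WithLp.fstL 2 ℝ (L2 K) (L2v K))).comp (H1 K).subtypeL

theorem greenFunctional_apply {d : ℕ} {K : Set (Space d)} (q : Hdiv K) (w : H1 K) :
    greenFunctional q w = ⟪q.1.fst, w.1.snd⟫_ℝ + ⟪q.1.snd, w.1.fst⟫_ℝ := rfl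

theorem H10_le_ker_greenFunctional {d : ℕ} {K : Set (Space d)} (q : Hdiv K) :
    H10 K ≤ (greenFunctional q).ker := by
  refine Submodule.topologicalClosure_minimal _ ?_ (greenFunctional q).isClosed_ker
  rw [Submodule.span_le]
  rintro w ⟨φ, hφ, h1, h2⟩
  change greenFunctional q w = 0
  rw [greenFunctional_apply, L2.inner_def, L2.inner_def]
  have e1 : ∫ x in K, ⟪q.1.fst x, w.1.snd x⟫_ℝ = ∫ x in K, ⟪q.1.fst x, gradient φ x⟫_ℝ :=
    integral_congr_ae (by filter_upwards [h2] with x hx; rw [hx])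
  have e2 : ∫ x in K, ⟪q.1.snd x, w.1.fst x⟫_ℝ = ∫ x in K, ⟪q.1.snd x, φ x⟫_ℝ :=
    integral_congr_ae (by filter_upwards [h1] with x hx; rw [hx])
  rw [e1, e2, q.2 () φ hφ, neg_add_cancel]

/-- The normal trace `q ↦ (q · n_K)|_{∂K} ∈ H^{-1/2}(∂K)`, defined through Green's formula
`⟨q · n_K, w|_{∂K}⟩_{∂K} = (q, ∇w)_K + (div q, w)_K` for `w ∈ H¹(K)`. -/
def normalTrace {d : ℕ} (K : Set (Space d)) : Hdiv K →ₗ[ℝ] Hmhalf K where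
  toFun q := (H10 K).liftQL (greenFunctional q) (H10_le_ker_greenFunctional q)
  map_add' p q := by
    refine ContinuousLinearMap.ext fun w => Submodule.Quotient.induction_on _ w fun w => ?_
    change greenFunctional (p + q) w = greenFunctional p w + greenFunctional q w
    simp only [greenFunctional_apply, Submodule.coe_add, WithLp.add_fst, WithLp.add_snd,
      inner_add_left]
    ring
  map_smul' c q := by
    refine ContinuousLinearMap.ext fun w => Submodule.Quotient.induction_on _ w fun w => ?_
    change greenFunctional (c • q) w = c * greenFunctional q w
    simp only [greenFunctional_apply, Submodule.coe_smul, WithLp.smul_fst, WithLp.smul_snd,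
      real_inner_smul_left]
    ring

theorem normalTrace_trace {d : ℕ} (K : Set (Space d)) (q : Hdiv K) (w : H1 K) :
    normalTrace K q (trace K w) = ⟪q.1.fst, w.1.snd⟫_ℝ + ⟪q.1.snd, w.1.fst⟫_ℝ := rfl

/-! ## Skeleton trace spaces and skeleton dualities -/

/-- `H^{1/2}_{00}(𝒮)`: the families of element traces `(w|_{∂K})_K` of functions `w ∈ H¹₀(Ω)`. -/
def skeletonHalf {d : ℕ} {Ω : Set (Space d)} (hΩ : IsOpen Ω) (T : Mesh Ω) :
    Submodule ℝ (∀ j : Fin T.card, Hhalf (T.elem j)) :=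
  (H10 Ω).map (LinearMap.pi fun j =>
    trace (T.elem j) ∘ₗ restrictH1 T j ∘ₗ Submodule.inclusion (H1_le_brokenH1 hΩ T))

/-- `H^{-1/2}(𝒮)`: the families of element normal traces `((q · n_K)|_{∂K})_K` of
vector fields `q ∈ H(div, Ω)`. -/
def skeletonMhalf {d : ℕ} {Ω : Set (Space d)} (hΩ : IsOpen Ω) (T : Mesh Ω) :
    Submodule ℝ (∀ j : Fin T.card, Hmhalf (T.elem j)) :=
  LinearMap.range (LinearMap.pi fun j =>
    normalTrace (T.elem j) ∘ₗ restrictHdiv T j ∘ₗ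
      Submodule.inclusion (Hdiv_le_brokenHdiv hΩ T))

/-- `⟨[τ · n], ŵ⟩_𝒮 = ∑_K ⟨τ · n_K, ŵ⟩_{∂K}`. -/
def jumpNormal {d : ℕ} {Ω : Set (Space d)} {hΩ : IsOpen Ω} {T : Mesh Ω}
    (τ : brokenHdiv T) (w : skeletonHalf hΩ T) : ℝ :=
  ∑ j, normalTrace (T.elem j) (restrictHdiv T j τ) (w.1 j)

/-- `⟨[v], q̂⟩_𝒮 = ∑_K ⟨v, q̂⟩_{∂K}`. -/
def jump {d : ℕ} {Ω : Set (Space d)} {hΩ : IsOpen Ω} {T : Mesh Ω}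
    (v : brokenH1 T) (q : skeletonMhalf hΩ T) : ℝ :=
  ∑ j, q.1 j (trace (T.elem j) (restrictH1 T j v))

/-! ## The ultra-weak formulation and the DPG scheme -/

/-- The ansatz space `X = L²(Ω) × L²(Ω)^d × H^{1/2}_{00}(𝒮) × H^{-1/2}(𝒮)`, with elements
`(u, σ, û, σ̂)`. -/
def X {d : ℕ} {Ω : Set (Space d)} (hΩ : IsOpen Ω) (T : Mesh Ω) : Type :=
  L2 Ω × L2v Ω × skeletonHalf hΩ T × skeletonMhalf hΩ T

instance {d : ℕ} {Ω : Set (Space d)} (hΩ : IsOpen Ω) (T : Mesh Ω) : AddCommGroup (X hΩ T) :=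
  inferInstanceAs (AddCommGroup (L2 Ω × L2v Ω × skeletonHalf hΩ T × skeletonMhalf hΩ T))

instance {d : ℕ} {Ω : Set (Space d)} (hΩ : IsOpen Ω) (T : Mesh Ω) : Module ℝ (X hΩ T) :=
  inferInstanceAs (Module ℝ (L2 Ω × L2v Ω × skeletonHalf hΩ T × skeletonMhalf hΩ T))

/-- The test space `Y = H¹(𝒯) × H(div, 𝒯)`, with elements `(v, τ)`. -/
abbrev Y {d : ℕ} {Ω : Set (Space d)} (T : Mesh Ω) := brokenH1 T × brokenHdiv T

section Scheme

variable {d : ℕ} {Ω : Set (Space d)} {hΩ : IsOpen Ω} {T : Mesh Ω}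

/-- The ultra-weak bilinear form of the Laplacian,
`b(u, v) = (u, div τ)_𝒯 + (σ, ∇v + τ)_𝒯 - ⟨û, [τ · n]⟩_𝒮 - ⟨σ̂, [v]⟩_𝒮`. -/
def b (u : X hΩ T) (v : Y T) : ℝ :=
  ⟪u.1, v.2.1.snd⟫_ℝ + ⟪u.2.1, v.1.1.snd + v.2.1.fst⟫_ℝ
    - jumpNormal v.2 u.2.2.1 - jump v.1 u.2.2.2

/-- The extended bilinear form `b_e(u, v) = k⁻¹ (u, v) + b(u, v)` for the time step `k`. -/
def be (k : ℝ) (u : X hΩ T) (v : Y T) : ℝ := k⁻¹ * ⟪u.1, v.1.1.fst⟫_ℝ + b u v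

/-- The right-hand side functional `L_e(u; v) = (f + k⁻¹ u, v)`. -/
def Le (k : ℝ) (f u : L2 Ω) (v : Y T) : ℝ := ⟪f + k⁻¹ • u, v.1.1.fst⟫_ℝ

/-- The inner product of `Y` that induces the weighted test norm
`‖(v, τ)‖² = k⁻² ‖v‖² + k⁻¹ ‖∇v‖²_𝒯 + k⁻¹ ‖τ‖² + ‖div τ‖²_𝒯`. -/
def testInner (k : ℝ) (v w : Y T) : ℝ :=
  (k ^ 2)⁻¹ * ⟪v.1.1.fst, w.1.1.fst⟫_ℝ + k⁻¹ * ⟪v.1.1.snd, w.1.1.snd⟫_ℝ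
    + k⁻¹ * ⟪v.2.1.fst, w.2.1.fst⟫_ℝ + ⟪v.2.1.snd, w.2.1.snd⟫_ℝ

/-- `θ = Θ u` is the optimal test function of `u`, i.e. the Riesz representative of `be k u` with
respect to `testInner k` (for `k > 0` it is uniquely determined by `u`). -/
def IsOptimalTest (k : ℝ) (u : X hΩ T) (θ : Y T) : Prop :=
  ∀ v : Y T, testInner k θ v = be k u v

/-- The discrete test space `Y_h = Θ X_h`. -/
def optimalTestSpace (k : ℝ) (Xh : Submodule ℝ (X hΩ T)) : Set (Y T) :=
  {θ | ∃ u ∈ Xh, IsOptimalTest k u θ}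

end Scheme

section Time

variable {d : ℕ} {Ω : Set (Space d)} {hΩ : IsOpen Ω} {N : ℕ} {T : Fin (N + 1) → Mesh Ω}

/-- The time step `k_n = t_n - t_{n-1}`. The index `n : Fin N` stands for the step from
`t n.castSucc` to `t n.succ`. -/
def step (t : Fin (N + 1) → ℝ) (n : Fin N) : ℝ := t n.succ - t n.castSucc

/-- The first components `u_h^0, u_h^1, …, u_h^N`. -/
def field (u0h : L2 Ω) (U : ∀ n : Fin N, X hΩ (T n.succ)) : Fin (N + 1) → L2 Ω :=
  Fin.cons u0h fun n => (U n).1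

/-- `(u_h^0, (𝐮_h^n)_n)` solves the fully discrete DPG scheme. -/
structure IsDPGSolution (t : Fin (N + 1) → ℝ) (f : ℝ → L2 Ω) (u0 : L2 Ω)
    (X0h : Submodule ℝ (L2 Ω)) (Xh : ∀ n : Fin N, Submodule ℝ (X hΩ (T n.succ)))
    (u0h : L2 Ω) (U : ∀ n : Fin N, X hΩ (T n.succ)) : Prop where
  init_mem : u0h ∈ X0h
  init : ∀ v ∈ X0h, ⟪u0h, v⟫_ℝ = ⟪u0, v⟫_ℝ
  mem : ∀ n, U n ∈ Xh n
  eq : ∀ n, ∀ v ∈ optimalTestSpace (step t n) (Xh n),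
    be (step t n) (U n) v = Le (step t n) (f (t n.succ)) (field u0h U n.castSucc) v

end Time

end

end DPG

/-!
The Riesz representation theorem provides an optimal test function for every trial function, so
each time step is a finite-dimensional square system with the form `⟪Θu, Θw⟫` of the test space.
It is uniquely solvable as soon as `u ↦ be k u ·` is injective, and testing with `Θu` gives
`‖Θu‖² = (f + u' / k, v) ≤ (k ‖f‖ + ‖u'‖) ‖Θu‖`, where `v` is the first component of `Θu` and `u'`
the solution at the previous time. Everything else follows from the lower bound
`‖u‖² + k ‖σ‖² ≤ ‖Θu‖²` (`le_testInner_of_isOptimalTest`).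

For the lower bound, let `v ∈ H¹₀(Ω)` and `τ ∈ H(div, Ω)` solve `v / k + div τ = u` and
`∇v + τ = k σ`; by Lax–Milgram, this reaction–diffusion problem has a solution
(`exists_reaction_diffusion`). Conforming functions have no jumps, so that
`be k u (v, τ) = ‖u‖² + k ‖σ‖²`. As `(v, div τ) + (∇v, τ) = 0`, the squared test norm of `(v, τ)`
has the same value (`exists_conforming_test`), and the bound follows by testing `Θu` with `(v, τ)`.

Injectivity (`beL_injective`): the lower bound gives `u = 0` and `σ = 0` when `be k u` vanishes.
Test functions supported in a single element `K` then show that the trace components vanish on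
every `∂K`. For the normal trace component this is immediate. For the other one, a function
`w ∈ H¹(K)` that is annihilated by all normal traces lies in `H¹₀(K)`: if `z` is its component
orthogonal to `H¹₀(K)`, then `div ∇z = z`, and testing with the vector field `∇z` gives `z = 0`
(`mem_H10_of_forall_Hdiv`).

The bound over all time steps is the telescoping sum of the bounds for the single steps, because
the initial value is an `L²` projection.
-/

namespace DPG

/-! ### Restriction and extension by zero in `L²` -/

section Lebesgue

variable {d : ℕ} {U K Ω : Set (Space d)}

theorem norm_restrictL2_le {F : Type*} [NormedAddCommGroup F] [NormedSpace ℝ F] (h : K ⊆ U)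
    (v : Lp F 2 (volume.restrict U)) : ‖restrictL2 h v‖ ≤ ‖v‖ := by
  change ‖MemLp.toLp v ((Lp.memLp v).mono_measure (Measure.restrict_mono h le_rfl))‖ ≤ _
  rw [Lp.norm_toLp, Lp.norm_def]
  exact ENNReal.toReal_mono (Lp.eLpNorm_ne_top v)
    (eLpNorm_mono_measure _ (Measure.restrict_mono h le_rfl))

theorem continuous_restrictL2 {F : Type*} [NormedAddCommGroup F] [NormedSpace ℝ F] (h : K ⊆ U) :
    Continuous (restrictL2 (F := F) h) :=
  AddMonoidHomClass.continuous_of_bound _ 1 fun v => by simpa using norm_restrictL2_le h v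

theorem inner_restrictL2 {F : Type*} [NormedAddCommGroup F] [InnerProductSpace ℝ F] (h : K ⊆ U)
    (v w : Lp F 2 (volume.restrict U)) :
    ⟪restrictL2 h v, restrictL2 h w⟫_ℝ = ∫ x in K, ⟪v x, w x⟫_ℝ := by
  rw [L2.inner_def]
  refine integral_congr_ae ?_
  filter_upwards [restrictL2_coe h v, restrictL2_coe h w] with x hv hw
  rw [hv, hw]

theorem sum_inner_restrictL2 {F : Type*} [NormedAddCommGroup F] [InnerProductSpace ℝ F]
    (T : Mesh Ω) (v w : Lp F 2 (volume.restrict Ω)) :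
    ∑ j, ⟪restrictL2 (T.subset j) v, restrictL2 (T.subset j) w⟫_ℝ = ⟪v, w⟫_ℝ := by
  have hsub : (⋃ j, T.elem j) ⊆ Ω := Set.iUnion_subset T.subset
  have hae : (⋃ j, T.elem j) =ᵐ[volume] Ω :=
    Filter.EventuallyLE.antisymm hsub.eventuallyLE (ae_le_set.2 T.cover)
  have hint : Integrable (fun x => ⟪v x, w x⟫_ℝ) (volume.restrict Ω) :=
    L2.integrable_inner v w
  simp_rw [inner_restrictL2]
  rw [L2.inner_def, ← setIntegral_congr_set hae,
    integral_iUnion_fintype (fun j => (T.isOpen j).measurableSet) T.disjoint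
      fun j => hint.mono_measure (Measure.restrict_mono (T.subset j) le_rfl)]

/-- A function in `L²(K_j)` extends by zero to `L²(Ω)`. -/
theorem exists_zero_extension {F : Type*} [NormedAddCommGroup F] [NormedSpace ℝ F]
    (T : Mesh Ω) (j : Fin T.card) (v : Lp F 2 (volume.restrict (T.elem j))) :
    ∃ V : Lp F 2 (volume.restrict Ω), V =ᵐ[volume.restrict (T.elem j)] v ∧
      ∀ i ≠ j, V =ᵐ[volume.restrict (T.elem i)] fun _ => 0 := by
  have hm (i : Fin T.card) : MeasurableSet (T.elem i) := (T.isOpen i).measurableSet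
  have h := ((memLp_indicator_iff_restrict (hm j)).2 (Lp.memLp v)).restrict Ω
  have hV (i : Fin T.card) : h.toLp =ᵐ[volume.restrict (T.elem i)] (T.elem j).indicator v :=
    ae_mono (Measure.restrict_mono (T.subset i) le_rfl) h.coeFn_toLp
  refine ⟨h.toLp, (hV j).trans (indicator_ae_eq_restrict (hm j)), fun i hij => (hV i).trans ?_⟩
  filter_upwards [ae_restrict_mem (hm i)] with x hx
  exact Set.indicator_of_notMem (Set.disjoint_left.1 (T.disjoint hij) hx) _

theorem restrictL2_eq {F : Type*} [NormedAddCommGroup F] [NormedSpace ℝ F] (h : K ⊆ U)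
    {v : Lp F 2 (volume.restrict U)} {w : Lp F 2 (volume.restrict K)}
    (hvw : v =ᵐ[volume.restrict K] w) : restrictL2 h v = w :=
  Lp.ext ((restrictL2_coe h v).trans hvw)

theorem restrictL2_eq_zero {F : Type*} [NormedAddCommGroup F] [NormedSpace ℝ F] (h : K ⊆ U)
    {v : Lp F 2 (volume.restrict U)} (hv : v =ᵐ[volume.restrict K] fun _ => 0) :
    restrictL2 h v = 0 :=
  restrictL2_eq h (hv.trans (Lp.coeFn_zero _ _ _).symm)

end Lebesgue

/-! ### Sobolev spaces -/

section Sobolev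

variable {d : ℕ} {U K Ω : Set (Space d)}

theorem HasWeakGrad.of_isTestFun {φ : Space d → ℝ} (hφ : IsTestFun U φ) :
    HasWeakGrad U φ (gradient φ) := by
  intro ψ hψ
  have hinner (χ : Space d → ℝ) (x c : Space d) : ⟪c, gradient χ x⟫_ℝ = fderiv ℝ χ x c := by
    rw [real_inner_comm, IsTestFun.gradient_eq, InnerProductSpace.toDual_symm_apply]
  have hcont {χ : Space d → ℝ} (hχ : IsTestFun U χ) (c : Space d) :
      Continuous fun x => fderiv ℝ χ x c :=
    (hχ.smooth.continuous_fderiv (by simp)).clm_apply continuous_const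
  refine ext_inner_left ℝ fun c => ?_
  rw [inner_neg_right,
    ← integral_inner (integrable_smul_two hφ.memLp hψ.memLp_gradient),
    ← integral_inner (integrable_smul_two hψ.memLp hφ.memLp_gradient)]
  simp only [inner_smul_right, hinner]
  rw [setIntegral_eq_integral_of_forall_compl_eq_zero
      (fun x hx => by simp [hφ.eq_zero hx]),
    setIntegral_eq_integral_of_forall_compl_eq_zero
      (fun x hx => by simp [hψ.eq_zero hx])]
  rw [integral_mul_fderiv_eq_neg_fderiv_mul_of_integrable]
  · simp only [mul_comm]
  · exact ((hcont hφ c).mul hψ.smooth.continuous).integrable_of_hasCompactSupport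
      hψ.compact.mul_left
  · exact (hφ.smooth.continuous.mul (hcont hψ c)).integrable_of_hasCompactSupport
      hφ.compact.mul_right
  · exact (hφ.smooth.continuous.mul hψ.smooth.continuous).integrable_of_hasCompactSupport
      hφ.compact.mul_right
  · exact fun x _ => hφ.smooth.differentiable (by simp) x
  · exact fun x _ => hψ.smooth.differentiable (by simp) x

/-- A test function, as an element of `H¹₀(U)`. -/
theorem IsTestFun.exists_mem_H10 {φ : Space d → ℝ} (hφ : IsTestFun U φ) :
    ∃ w ∈ H10 U, w.1.fst =ᵐ[volume.restrict U] φ ∧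
      w.1.snd =ᵐ[volume.restrict U] gradient φ := by
  have h1 := hφ.memLp.coeFn_toLp
  have h2 := hφ.memLp_gradient.coeFn_toLp
  refine ⟨⟨WithLp.toLp 2 (hφ.memLp.toLp, hφ.memLp_gradient.toLp),
    fun _ => (HasWeakGrad.of_isTestFun hφ).congr h1 h2⟩, ?_, h1, h2⟩
  exact Submodule.le_topologicalClosure _ (Submodule.subset_span ⟨φ, hφ, h1, h2⟩)

/-- Orthogonality to `H¹₀(U)` in the sense of Green's formula characterizes the weak divergence. -/
theorem HasWeakDiv.of_forall_H10 {τ : L2v U} {δ : L2 U}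
    (h : ∀ w ∈ H10 U, ⟪τ, w.1.snd⟫_ℝ + ⟪δ, w.1.fst⟫_ℝ = 0) : HasWeakDiv U τ δ := by
  intro φ hφ
  obtain ⟨w, hw, h1, h2⟩ := hφ.exists_mem_H10
  have h0 := h w hw
  rw [L2.inner_def, L2.inner_def] at h0
  rw [eq_neg_iff_add_eq_zero, ← h0]
  congr 1 <;> refine integral_congr_ae ?_
  · filter_upwards [h2] with x hx
    rw [hx]
  · filter_upwards [h1] with x hx
    rw [hx]

/-- Green's formula without boundary term. -/
theorem inner_add_inner_eq_zero_of_mem_H10 (q : Hdiv U) {w : H1 U} (hw : w ∈ H10 U) :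
    ⟪q.1.fst, w.1.snd⟫_ℝ + ⟪q.1.snd, w.1.fst⟫_ℝ = 0 :=
  H10_le_ker_greenFunctional q hw

theorem isClosed_familyH1 {ι : Type} (K : ι → Set (Space d)) (hK : ∀ j, K j ⊆ Ω) :
    IsClosed (familyH1 Ω K hK : Set (WithLp 2 (L2 Ω × L2v Ω))) := by
  have : (familyH1 Ω K hK : Set (WithLp 2 (L2 Ω × L2v Ω))) =
      ⋂ (j) (φ : Space d → ℝ) (_ : IsTestFun (K j) φ),
        {p | ∫ x in K j, p.fst x • gradient φ x = -∫ x in K j, φ x • p.snd x} := by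
    ext p
    simp only [Set.mem_iInter, Set.mem_ofPred_eq]
    rfl
  rw [this]
  refine isClosed_iInter fun j => isClosed_iInter fun φ => isClosed_iInter fun hφ => ?_
  have e1 (p : WithLp 2 (L2 Ω × L2v Ω)) : ∫ x in K j, p.fst x • gradient φ x =
      (ContinuousLinearMap.lsmul ℝ ℝ).lpPairing (volume.restrict (K j)) 2 2
        (restrictL2 (hK j) p.fst) hφ.memLp_gradient.toLp := by
    rw [ContinuousLinearMap.lpPairing_eq_integral]
    refine integral_congr_ae ?_
    filter_upwards [restrictL2_coe (hK j) p.fst, hφ.memLp_gradient.coeFn_toLp] with x h1 h2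
    rw [h1, h2]
    rfl
  have e2 (p : WithLp 2 (L2 Ω × L2v Ω)) : ∫ x in K j, φ x • p.snd x =
      (ContinuousLinearMap.lsmul ℝ ℝ).lpPairing (volume.restrict (K j)) 2 2
        hφ.memLp.toLp (restrictL2 (hK j) p.snd) := by
    rw [ContinuousLinearMap.lpPairing_eq_integral]
    refine integral_congr_ae ?_
    filter_upwards [restrictL2_coe (hK j) p.snd, hφ.memLp.coeFn_toLp] with x h1 h2
    rw [h1, h2]
    rfl
  simp only [e1, e2]
  have c1 : Continuous fun p : WithLp 2 (L2 Ω × L2v Ω) => restrictL2 (hK j) p.fst :=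
    (continuous_restrictL2 _).comp (WithLp.fstL 2 ℝ (L2 Ω) (L2v Ω)).continuous
  have c2 : Continuous fun p : WithLp 2 (L2 Ω × L2v Ω) => restrictL2 (hK j) p.snd :=
    (continuous_restrictL2 _).comp (WithLp.sndL 2 ℝ (L2 Ω) (L2v Ω)).continuous
  exact isClosed_eq
    ((ContinuousLinearMap.continuous _).comp c1 |>.clm_apply continuous_const)
    ((ContinuousLinearMap.continuous _).comp c2).neg

theorem isClosed_familyHdiv {ι : Type} (K : ι → Set (Space d)) (hK : ∀ j, K j ⊆ Ω) :
    IsClosed (familyHdiv Ω K hK : Set (WithLp 2 (L2v Ω × L2 Ω))) := by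
  have : (familyHdiv Ω K hK : Set (WithLp 2 (L2v Ω × L2 Ω))) =
      ⋂ (j) (φ : Space d → ℝ) (_ : IsTestFun (K j) φ),
        {p | ∫ x in K j, ⟪p.fst x, gradient φ x⟫_ℝ = -∫ x in K j, ⟪p.snd x, φ x⟫_ℝ} := by
    ext p
    simp only [Set.mem_iInter, Set.mem_ofPred_eq]
    rfl
  rw [this]
  refine isClosed_iInter fun j => isClosed_iInter fun φ => isClosed_iInter fun hφ => ?_
  have e1 (p : WithLp 2 (L2v Ω × L2 Ω)) : ∫ x in K j, ⟪p.fst x, gradient φ x⟫_ℝ =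
      ⟪restrictL2 (hK j) p.fst, hφ.memLp_gradient.toLp⟫_ℝ := by
    rw [L2.inner_def]
    refine integral_congr_ae ?_
    filter_upwards [restrictL2_coe (hK j) p.fst, hφ.memLp_gradient.coeFn_toLp] with x h1 h2
    rw [h1, h2]
  have e2 (p : WithLp 2 (L2v Ω × L2 Ω)) : ∫ x in K j, ⟪p.snd x, φ x⟫_ℝ =
      ⟪restrictL2 (hK j) p.snd, hφ.memLp.toLp⟫_ℝ := by
    rw [L2.inner_def]
    refine integral_congr_ae ?_
    filter_upwards [restrictL2_coe (hK j) p.snd, hφ.memLp.coeFn_toLp] with x h1 h2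
    rw [h1, h2]
  simp only [e1, e2]
  have c1 : Continuous fun p : WithLp 2 (L2v Ω × L2 Ω) => restrictL2 (hK j) p.fst :=
    (continuous_restrictL2 _).comp (WithLp.fstL 2 ℝ (L2v Ω) (L2 Ω)).continuous
  have c2 : Continuous fun p : WithLp 2 (L2v Ω × L2 Ω) => restrictL2 (hK j) p.snd :=
    (continuous_restrictL2 _).comp (WithLp.sndL 2 ℝ (L2v Ω) (L2 Ω)).continuous
  exact isClosed_eq (c1.inner continuous_const) (c2.inner continuous_const).neg

instance {ι : Type} (K : ι → Set (Space d)) (hK : ∀ j, K j ⊆ Ω) :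
    CompleteSpace (familyH1 Ω K hK) :=
  (isClosed_familyH1 K hK).completeSpace_coe

instance {ι : Type} (K : ι → Set (Space d)) (hK : ∀ j, K j ⊆ Ω) :
    CompleteSpace (familyHdiv Ω K hK) :=
  (isClosed_familyHdiv K hK).completeSpace_coe

instance (U : Set (Space d)) : CompleteSpace (H10 U) :=
  (isClosed_H10 U).completeSpace_coe

/-- The normal traces of `H(div, K)` separate the points of the trace space `H^{1/2}(∂K)`. -/
theorem mem_H10_of_forall_Hdiv {w : H1 K}
    (h : ∀ q : Hdiv K, ⟪q.1.fst, w.1.snd⟫_ℝ + ⟪q.1.snd, w.1.fst⟫_ℝ = 0) : w ∈ H10 K := by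
  have hinner (a c : H1 K) : ⟪a, c⟫_ℝ = ⟪a.1.fst, c.1.fst⟫_ℝ + ⟪a.1.snd, c.1.snd⟫_ℝ := rfl
  obtain ⟨y, hy, z, hz, rfl⟩ := (H10 K).exists_add_mem_mem_orthogonal w
  -- `z ⟂ H¹₀(K)` means that the gradient of `z` has the weak divergence `z`
  have hdiv : HasWeakDiv K z.1.snd z.1.fst := .of_forall_H10 fun φ hφ => by
    have h0 := (Submodule.mem_orthogonal' _ _).1 hz φ hφ
    rw [hinner] at h0
    rw [add_comm]
    exact h0
  have h1 := h ⟨WithLp.toLp 2 (z.1.snd, z.1.fst), fun _ => hdiv⟩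
  have h2 : ⟪z, y + z⟫_ℝ = 0 := by
    rw [hinner, add_comm]
    exact h1
  rw [inner_add_right, (Submodule.mem_orthogonal' _ _).1 hz y hy, zero_add,
    inner_self_eq_zero] at h2
  rwa [h2, add_zero]

/-- Extension by zero maps `H¹(K_j)` into `H¹(𝒯)`, since no interelement continuity is required. -/
theorem exists_restrictH1_eq (T : Mesh Ω) (j : Fin T.card) (w : H1 (T.elem j)) :
    ∃ v : brokenH1 T, restrictH1 T j v = w ∧ ∀ i ≠ j, restrictH1 T i v = 0 := by
  obtain ⟨V, hV, hV0⟩ := exists_zero_extension T j w.1.fst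
  obtain ⟨G, hG, hG0⟩ := exists_zero_extension T j w.1.snd
  have hVG : WithLp.toLp 2 (V, G) ∈ brokenH1 T := fun i => by
    obtain rfl | hij := eq_or_ne i j
    · exact (w.2 ()).congr hV hG
    · exact HasWeakGrad.zero.congr (hV0 i hij) (hG0 i hij)
  refine ⟨⟨_, hVG⟩, ?_, fun i hij => ?_⟩
  · exact Subtype.ext (congrArg (WithLp.toLp 2)
      (Prod.ext (restrictL2_eq (T.subset j) hV) (restrictL2_eq (T.subset j) hG)))
  · exact Subtype.ext (congrArg (WithLp.toLp 2)
      (Prod.ext (restrictL2_eq_zero (T.subset i) (hV0 i hij))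
        (restrictL2_eq_zero (T.subset i) (hG0 i hij))))

/-- Extension by zero maps `H(div, K_j)` into `H(div, 𝒯)`. -/
theorem exists_restrictHdiv_eq (T : Mesh Ω) (j : Fin T.card) (q : Hdiv (T.elem j)) :
    ∃ v : brokenHdiv T, restrictHdiv T j v = q ∧ ∀ i ≠ j, restrictHdiv T i v = 0 := by
  obtain ⟨V, hV, hV0⟩ := exists_zero_extension T j q.1.fst
  obtain ⟨G, hG, hG0⟩ := exists_zero_extension T j q.1.snd
  have hVG : WithLp.toLp 2 (V, G) ∈ brokenHdiv T := fun i => by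
    obtain rfl | hij := eq_or_ne i j
    · exact (q.2 ()).congr hV hG
    · exact HasWeakDiv.zero.congr (hV0 i hij) (hG0 i hij)
  refine ⟨⟨_, hVG⟩, ?_, fun i hij => ?_⟩
  · exact Subtype.ext (congrArg (WithLp.toLp 2)
      (Prod.ext (restrictL2_eq (T.subset j) hV) (restrictL2_eq (T.subset j) hG)))
  · exact Subtype.ext (congrArg (WithLp.toLp 2)
      (Prod.ext (restrictL2_eq_zero (T.subset i) (hV0 i hij))
        (restrictL2_eq_zero (T.subset i) (hG0 i hij))))

end Sobolev
end DPG

/-! ### Lax–Milgram and discrete problems with optimal test functions -/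

/-- The Lax–Milgram theorem. -/
theorem IsCoercive.exists_eq {V : Type*} [NormedAddCommGroup V] [InnerProductSpace ℝ V]
    [CompleteSpace V] {B : V →L[ℝ] V →L[ℝ] ℝ} (hB : IsCoercive B) (ℓ : V →L[ℝ] ℝ) :
    ∃ x, ∀ y, B x y = ℓ y := by
  refine ⟨hB.continuousLinearEquivOfBilin.symm ((InnerProductSpace.toDual ℝ V).symm ℓ),
    fun y => ?_⟩
  rw [← hB.continuousLinearEquivOfBilin_apply, ContinuousLinearEquiv.apply_symm_apply,
    InnerProductSpace.toDual_symm_apply]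

/-- Well-posedness of a discrete problem with optimal test functions: if `Θ` is the trial-to-test
operator of `β`, then `β u (Θ w) = B (Θ u) (Θ w)` is nondegenerate on every finite-dimensional
trial space. -/
theorem IsCoercive.existsUnique_optimalTest {X V : Type*} [AddCommGroup X] [Module ℝ X]
    [NormedAddCommGroup V] [InnerProductSpace ℝ V] [CompleteSpace V]
    {B : V →L[ℝ] V →L[ℝ] ℝ} (hB : IsCoercive B) (β : X →ₗ[ℝ] V →L[ℝ] ℝ)
    (hβ : Function.Injective β) (ℓ : V →L[ℝ] ℝ) (Xh : Submodule ℝ X) [FiniteDimensional ℝ Xh] :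
    ∃! u, u ∈ Xh ∧ ∀ θ, (∃ w ∈ Xh, ∀ v, B θ v = β w v) → β u θ = ℓ θ := by
  have hB0 (θ : V) (h : B θ θ = 0) : θ = 0 := by
    obtain ⟨C, hC, h'⟩ := hB
    have h1 := h' θ
    rw [h, mul_assoc] at h1
    have h2 : ‖θ‖ * ‖θ‖ ≤ 0 := nonpos_of_mul_nonpos_right h1 hC
    exact norm_eq_zero.1 (mul_self_eq_zero.1 (h2.antisymm (mul_self_nonneg _)))
  let Θ : X →ₗ[ℝ] V := hB.continuousLinearEquivOfBilin.symm.toLinearMap ∘ₗ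
    (InnerProductSpace.toDual ℝ V).symm.toLinearEquiv.toLinearMap ∘ₗ β
  have hΘ (w : X) (v : V) : B (Θ w) v = β w v := by
    rw [← hB.continuousLinearEquivOfBilin_apply]
    change ⟪hB.continuousLinearEquivOfBilin (hB.continuousLinearEquivOfBilin.symm
      ((InnerProductSpace.toDual ℝ V).symm (β w))), v⟫_ℝ = _
    rw [ContinuousLinearEquiv.apply_symm_apply, InnerProductSpace.toDual_symm_apply]
  have hΘu (w : X) (θ : V) (h : ∀ v, B θ v = β w v) : θ = Θ w :=
    sub_eq_zero.1 (hB0 _ (by rw [map_sub B, _root_.sub_apply, h, hΘ, sub_self]))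
  let A : Xh →ₗ[ℝ] Module.Dual ℝ Xh := LinearMap.mk₂ ℝ (fun u w => β u (Θ w))
    (by simp) (by simp) (by simp) (by simp)
  have hA (u w : Xh) : A u w = β u (Θ w) := rfl
  have hAinj : Function.Injective A := by
    rw [← LinearMap.ker_eq_bot, LinearMap.ker_eq_bot']
    intro u hu
    have h1 : A u u = 0 := by rw [hu]; rfl
    rw [hA, ← hΘ] at h1
    have h2 : β u = β 0 := by
      ext v
      rw [← hΘ, hB0 _ h1]
      simp
    exact Subtype.ext (hβ h2)
  have hAsurj : Function.Surjective A :=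
    (LinearMap.injective_iff_surjective_of_finrank_eq_finrank
      Subspace.dual_finrank_eq.symm).1 hAinj
  obtain ⟨u, hu⟩ := hAsurj (ℓ.toLinearMap ∘ₗ Θ ∘ₗ Xh.subtype)
  refine ⟨u, ⟨u.2, ?_⟩, ?_⟩
  · rintro θ ⟨w, hw, hθ⟩
    rw [hΘu w θ hθ]
    exact LinearMap.congr_fun hu ⟨w, hw⟩
  · rintro u' ⟨hu', h⟩
    have : A ⟨u', hu'⟩ = A u := by
      rw [hu]
      ext w
      exact h _ ⟨w, w.2, hΘ w⟩
    exact congrArg Subtype.val (hAinj this)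

theorem Submodule.norm_sq_eq_of_prod {E F : Type*} [NormedAddCommGroup E] [InnerProductSpace ℝ E]
    [NormedAddCommGroup F] [InnerProductSpace ℝ F] (S : Submodule ℝ (WithLp 2 (E × F))) (v : S) :
    ‖v‖ ^ 2 = ‖v.1.fst‖ ^ 2 + ‖v.1.snd‖ ^ 2 :=
  WithLp.prod_norm_sq_eq_of_L2 _

/-- The weak form of a reaction–diffusion problem with reaction coefficient `c`: the maps `P` and
`G` stand for `v ↦ v` and `v ↦ ∇v`, and `V` for the space with graph norm. -/
theorem exists_reaction_diffusion_weak {V E F : Type*} [NormedAddCommGroup V]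
    [InnerProductSpace ℝ V] [CompleteSpace V] [NormedAddCommGroup E] [InnerProductSpace ℝ E]
    [NormedAddCommGroup F] [InnerProductSpace ℝ F] (P : V →L[ℝ] E) (G : V →L[ℝ] F)
    (hPG : ∀ v, ‖v‖ ^ 2 = ‖P v‖ ^ 2 + ‖G v‖ ^ 2) {c : ℝ} (hc : 0 < c)
    {S : Submodule ℝ V} (hS : IsClosed (S : Set V)) (f : E) (g : F) :
    ∃ v ∈ S, ∀ w ∈ S, c * ⟪P v, P w⟫_ℝ + ⟪G v, G w⟫_ℝ = ⟪f, P w⟫_ℝ + ⟪g, G w⟫_ℝ := by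
  have := hS.completeSpace_coe
  let P' : S →L[ℝ] E := P.comp S.subtypeL
  let G' : S →L[ℝ] F := G.comp S.subtypeL
  let B : S →L[ℝ] S →L[ℝ] ℝ :=
    c • (innerSL ℝ).bilinearComp P' P' + (innerSL ℝ).bilinearComp G' G'
  have hBapp (v w : S) : B v w = c * ⟪P v, P w⟫_ℝ + ⟪G v, G w⟫_ℝ := rfl
  have hB : IsCoercive B := by
    refine ⟨min c 1, by positivity, fun v => ?_⟩
    rw [mul_assoc, ← sq, Submodule.coe_norm, hPG, hBapp, real_inner_self_eq_norm_sq,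
      real_inner_self_eq_norm_sq]
    have e1 := mul_le_mul_of_nonneg_right (min_le_left c 1) (sq_nonneg ‖P v‖)
    have e2 := mul_le_mul_of_nonneg_right (min_le_right c 1) (sq_nonneg ‖G v‖)
    linarith
  obtain ⟨v, hv⟩ := hB.exists_eq ((innerSL ℝ f).comp P' + (innerSL ℝ g).comp G')
  exact ⟨v, v.2, fun w hw => hv ⟨w, hw⟩⟩

/-- If `u = p / k + s`, `k σ = g + r` and the mixed terms `(r, g) + (s, p)` cancel, then testing
with `(p, g, r, s)` and the weighted squared norm of `(p, g, r, s)` both give `‖u‖² + k ‖σ‖²`. -/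
theorem weighted_pythagoras {E F : Type*} [NormedAddCommGroup E] [InnerProductSpace ℝ E]
    [NormedAddCommGroup F] [InnerProductSpace ℝ F] {k : ℝ} (hk : 0 < k) {u p s : E} {σ g r : F}
    (hu : k⁻¹ • p + s = u) (hσ : g + r = k • σ) (h0 : ⟪r, g⟫_ℝ + ⟪s, p⟫_ℝ = 0) :
    k⁻¹ * ⟪u, p⟫_ℝ + (⟪u, s⟫_ℝ + ⟪σ, g + r⟫_ℝ) = ‖u‖ ^ 2 + k * ‖σ‖ ^ 2 ∧
      (k ^ 2)⁻¹ * ⟪p, p⟫_ℝ + k⁻¹ * ⟪g, g⟫_ℝ + k⁻¹ * ⟪r, r⟫_ℝ + ⟪s, s⟫_ℝ =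
        ‖u‖ ^ 2 + k * ‖σ‖ ^ 2 := by
  constructor
  · have e1 : ‖u‖ ^ 2 = k⁻¹ * ⟪u, p⟫_ℝ + ⟪u, s⟫_ℝ := by
      rw [← real_inner_smul_right, ← inner_add_right, hu, real_inner_self_eq_norm_sq]
    rw [e1, hσ, real_inner_smul_right, real_inner_self_eq_norm_sq]
    ring
  · have e1 : ‖u‖ ^ 2 = (k ^ 2)⁻¹ * ‖p‖ ^ 2 + 2 * (k⁻¹ * ⟪s, p⟫_ℝ) + ‖s‖ ^ 2 := by
      rw [← hu, norm_add_sq_real, norm_smul, real_inner_smul_left, mul_pow, Real.norm_eq_abs,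
        sq_abs, inv_pow, real_inner_comm]
    have e2 : k * ‖σ‖ ^ 2 = k⁻¹ * (‖g‖ ^ 2 + 2 * ⟪r, g⟫_ℝ + ‖r‖ ^ 2) := by
      rw [real_inner_comm, ← norm_add_sq_real, hσ, norm_smul, mul_pow, Real.norm_eq_abs, sq_abs]
      field_simp
    rw [e1, e2]
    simp only [real_inner_self_eq_norm_sq]
    linear_combination (-2 * k⁻¹) * h0

theorem two_mul_inner_le {E : Type*} [NormedAddCommGroup E] [InnerProductSpace ℝ E] (x y : E) :
    2 * ⟪x, y⟫_ℝ ≤ ⟪x, x⟫_ℝ + ⟪y, y⟫_ℝ := by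
  have := real_inner_self_nonneg (x := x - y)
  rw [real_inner_sub_sub_self] at this
  linarith

namespace DPG

/-! ### The forms on the broken test space -/

section Forms

variable {d : ℕ} {Ω : Set (Space d)} {hΩ : IsOpen Ω} {T : Mesh Ω}

theorem continuous_restrictH1 (T : Mesh Ω) (j : Fin T.card) : Continuous (restrictH1 T j) := by
  have c1 : Continuous fun v : brokenH1 T => restrictL2 (T.subset j) v.1.fst :=
    (continuous_restrictL2 _).comp
      ((WithLp.fstL 2 ℝ (L2 Ω) (L2v Ω)).continuous.comp continuous_subtype_val)
  have c2 : Continuous fun v : brokenH1 T => restrictL2 (T.subset j) v.1.snd :=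
    (continuous_restrictL2 _).comp
      ((WithLp.sndL 2 ℝ (L2 Ω) (L2v Ω)).continuous.comp continuous_subtype_val)
  exact ((WithLp.prod_continuous_toLp 2 _ _).comp (c1.prodMk c2)).subtype_mk _

theorem continuous_restrictHdiv (T : Mesh Ω) (j : Fin T.card) :
    Continuous (restrictHdiv T j) := by
  have c1 : Continuous fun v : brokenHdiv T => restrictL2 (T.subset j) v.1.fst :=
    (continuous_restrictL2 _).comp
      ((WithLp.fstL 2 ℝ (L2v Ω) (L2 Ω)).continuous.comp continuous_subtype_val)
  have c2 : Continuous fun v : brokenHdiv T => restrictL2 (T.subset j) v.1.snd :=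
    (continuous_restrictL2 _).comp
      ((WithLp.sndL 2 ℝ (L2v Ω) (L2 Ω)).continuous.comp continuous_subtype_val)
  exact ((WithLp.prod_continuous_toLp 2 _ _).comp (c1.prodMk c2)).subtype_mk _

theorem continuous_trace (K : Set (Space d)) : Continuous (trace K) :=
  AddMonoidHomClass.continuous_of_bound _ 1 fun w => by
    rw [one_mul]
    exact Submodule.Quotient.norm_mk_le (H10 K) w

theorem trace_surjective (K : Set (Space d)) : Function.Surjective (trace K) :=
  Submodule.mkQ_surjective _

theorem trace_eq_zero_iff {K : Set (Space d)} {w : H1 K} : trace K w = 0 ↔ w ∈ H10 K :=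
  Submodule.Quotient.mk_eq_zero _

theorem continuous_normalTrace_apply {K : Set (Space d)} (w : Hhalf K) :
    Continuous fun q : Hdiv K => normalTrace K q w := by
  obtain ⟨w, rfl⟩ := trace_surjective K w
  simp only [normalTrace_trace]
  have c1 : Continuous fun q : Hdiv K => q.1.fst :=
    (WithLp.fstL 2 ℝ (L2v K) (L2 K)).continuous.comp continuous_subtype_val
  have c2 : Continuous fun q : Hdiv K => q.1.snd :=
    (WithLp.sndL 2 ℝ (L2v K) (L2 K)).continuous.comp continuous_subtype_val
  exact (c1.inner continuous_const).add (c2.inner continuous_const)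

theorem continuous_jumpNormal (w : skeletonHalf hΩ T) :
    Continuous fun τ : brokenHdiv T => jumpNormal τ w :=
  continuous_finsetSum _ fun j _ =>
    (continuous_normalTrace_apply (w.1 j)).comp (continuous_restrictHdiv T j)

theorem continuous_jump (q : skeletonMhalf hΩ T) : Continuous fun v : brokenH1 T => jump v q :=
  continuous_finsetSum _ fun j _ =>
    (q.1 j).continuous.comp ((continuous_trace _).comp (continuous_restrictH1 T j))

/-- The test space `Y` with the Hilbert space structure inherited from `L²`. -/
def YHilbert (T : Mesh Ω) : Type := WithLp 2 (brokenH1 T × brokenHdiv T)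

noncomputable instance (T : Mesh Ω) : NormedAddCommGroup (YHilbert T) :=
  inferInstanceAs (NormedAddCommGroup (WithLp 2 (brokenH1 T × brokenHdiv T)))

noncomputable instance (T : Mesh Ω) : InnerProductSpace ℝ (YHilbert T) :=
  inferInstanceAs (InnerProductSpace ℝ (WithLp 2 (brokenH1 T × brokenHdiv T)))

instance (T : Mesh Ω) : CompleteSpace (YHilbert T) :=
  inferInstanceAs (CompleteSpace (WithLp 2 (brokenH1 T × brokenHdiv T)))

/-- The projection `(v, τ) ↦ v` of the test space. -/
noncomputable def toBrokenH1 (T : Mesh Ω) : YHilbert T →L[ℝ] brokenH1 T :=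
  WithLp.fstL 2 ℝ (brokenH1 T) (brokenHdiv T)

/-- The projection `(v, τ) ↦ τ` of the test space. -/
noncomputable def toBrokenHdiv (T : Mesh Ω) : YHilbert T →L[ℝ] brokenHdiv T :=
  WithLp.sndL 2 ℝ (brokenH1 T) (brokenHdiv T)

/-- The element of the product `Y` underlying an element of `YHilbert`. -/
noncomputable def YHilbert.toY (v : YHilbert T) : Y T := (toBrokenH1 T v, toBrokenHdiv T v)

/-- The map `(v, τ) ↦ v` from the test space to `L²(Ω)`. -/
noncomputable def valueL (T : Mesh Ω) : YHilbert T →L[ℝ] L2 Ω :=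
  (WithLp.fstL 2 ℝ _ _).comp ((brokenH1 T).subtypeL.comp (toBrokenH1 T))

/-- The map `(v, τ) ↦ ∇v`, with piecewise derivatives. -/
noncomputable def gradL (T : Mesh Ω) : YHilbert T →L[ℝ] L2v Ω :=
  (WithLp.sndL 2 ℝ _ _).comp ((brokenH1 T).subtypeL.comp (toBrokenH1 T))

/-- The map `(v, τ) ↦ τ` from the test space to `L²(Ω)^d`. -/
noncomputable def fieldL (T : Mesh Ω) : YHilbert T →L[ℝ] L2v Ω :=
  (WithLp.fstL 2 ℝ _ _).comp ((brokenHdiv T).subtypeL.comp (toBrokenHdiv T))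

/-- The map `(v, τ) ↦ div τ`, with piecewise derivatives. -/
noncomputable def divL (T : Mesh Ω) : YHilbert T →L[ℝ] L2 Ω :=
  (WithLp.sndL 2 ℝ _ _).comp ((brokenHdiv T).subtypeL.comp (toBrokenHdiv T))

/-- The inner product `testInner k`, as a bounded bilinear form. -/
noncomputable def testInnerL (k : ℝ) (T : Mesh Ω) : YHilbert T →L[ℝ] YHilbert T →L[ℝ] ℝ :=
  (k ^ 2)⁻¹ • (innerSL ℝ).bilinearComp (valueL T) (valueL T) +
    k⁻¹ • (innerSL ℝ).bilinearComp (gradL T) (gradL T) +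
    k⁻¹ • (innerSL ℝ).bilinearComp (fieldL T) (fieldL T) +
    (innerSL ℝ).bilinearComp (divL T) (divL T)

theorem norm_sq_YHilbert (v : YHilbert T) : ‖v‖ ^ 2 =
    (‖valueL T v‖ ^ 2 + ‖gradL T v‖ ^ 2) + (‖fieldL T v‖ ^ 2 + ‖divL T v‖ ^ 2) := by
  refine (WithLp.prod_norm_sq_eq_of_L2 (α := brokenH1 T) (β := brokenHdiv T) v).trans ?_
  exact congrArg₂ (· + ·) (Submodule.norm_sq_eq_of_prod _ _) (Submodule.norm_sq_eq_of_prod _ _)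

theorem testInnerL_self (k : ℝ) (v : YHilbert T) :
    testInnerL k T v v = (k ^ 2)⁻¹ * ‖valueL T v‖ ^ 2 + k⁻¹ * ‖gradL T v‖ ^ 2 +
      k⁻¹ * ‖fieldL T v‖ ^ 2 + ‖divL T v‖ ^ 2 := by
  simp only [← real_inner_self_eq_norm_sq]
  rfl

theorem isCoercive_testInnerL {k : ℝ} (hk : 0 < k) : IsCoercive (testInnerL k T) := by
  set c := min (min (k ^ 2)⁻¹ k⁻¹) 1 with hc
  refine ⟨c, by positivity, fun v => ?_⟩
  have h1 : c ≤ (k ^ 2)⁻¹ := (min_le_left _ _).trans (min_le_left _ _)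
  have h2 : c ≤ k⁻¹ := (min_le_left _ _).trans (min_le_right _ _)
  have h3 : c ≤ 1 := min_le_right _ _
  rw [mul_assoc, ← sq, norm_sq_YHilbert, testInnerL_self]
  have e1 := mul_le_mul_of_nonneg_right h1 (sq_nonneg ‖valueL T v‖)
  have e2 := mul_le_mul_of_nonneg_right h2 (sq_nonneg ‖gradL T v‖)
  have e3 := mul_le_mul_of_nonneg_right h2 (sq_nonneg ‖fieldL T v‖)
  have e4 := mul_le_mul_of_nonneg_right h3 (sq_nonneg ‖divL T v‖)
  linarith

/-- The form `be k`, as a linear map from `X` to the bounded functionals on `Y`. -/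
noncomputable def beL (k : ℝ) (hΩ : IsOpen Ω) (T : Mesh Ω) :
    X hΩ T →ₗ[ℝ] YHilbert T →L[ℝ] ℝ where
  toFun u :=
    { toFun v := be k u v.toY
      map_add' v w := by
        simp only [be, b, jumpNormal, jump, YHilbert.toY, map_add,
          Submodule.coe_add, WithLp.add_fst, WithLp.add_snd, inner_add_right,
          Finset.sum_add_distrib, _root_.add_apply]
        ring
      map_smul' c v := by
        simp only [be, b, jumpNormal, jump, YHilbert.toY, map_smul,
          Submodule.coe_smul, WithLp.smul_fst, WithLp.smul_snd, inner_add_right,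
          real_inner_smul_right, _root_.smul_apply, smul_eq_mul,
          ← Finset.mul_sum, RingHom.id_apply]
        ring
      cont := by
        have h1 : Continuous fun v : YHilbert T => ⟪u.1, v.toY.1.1.fst⟫_ℝ :=
          continuous_const.inner (valueL T).continuous
        have h2 : Continuous fun v : YHilbert T => ⟪u.1, v.toY.2.1.snd⟫_ℝ :=
          continuous_const.inner (divL T).continuous
        have h3 : Continuous fun v : YHilbert T => ⟪u.2.1, v.toY.1.1.snd + v.toY.2.1.fst⟫_ℝ :=
          continuous_const.inner ((gradL T).continuous.add (fieldL T).continuous)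
        have h4 : Continuous fun v : YHilbert T => jumpNormal v.toY.2 u.2.2.1 :=
          (continuous_jumpNormal _).comp (toBrokenHdiv T).continuous
        have h5 : Continuous fun v : YHilbert T => jump v.toY.1 u.2.2.2 :=
          (continuous_jump _).comp (toBrokenH1 T).continuous
        exact (continuous_const.mul h1).add (((h2.add h3).sub h4).sub h5) }
  map_add' u w := by
    ext v
    have e (u w : X hΩ T) : (u + w).1 = u.1 + w.1 ∧ (u + w).2.1 = u.2.1 + w.2.1 ∧
      (u + w).2.2.1 = u.2.2.1 + w.2.2.1 ∧ (u + w).2.2.2 = u.2.2.2 + w.2.2.2 :=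
      ⟨rfl, rfl, rfl, rfl⟩
    change be k (u + w) v.toY = be k u v.toY + be k w v.toY
    simp only [be, b, jumpNormal, jump, e, Submodule.coe_add, Pi.add_apply, inner_add_left, map_add,
      _root_.add_apply, Finset.sum_add_distrib]
    ring
  map_smul' c u := by
    ext v
    have e (u : X hΩ T) : (c • u).1 = c • u.1 ∧ (c • u).2.1 = c • u.2.1 ∧
      (c • u).2.2.1 = c • u.2.2.1 ∧ (c • u).2.2.2 = c • u.2.2.2 :=
      ⟨rfl, rfl, rfl, rfl⟩
    change be k (c • u) v.toY = c * be k u v.toY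
    simp only [be, b, jumpNormal, jump, e, Submodule.coe_smul, Pi.smul_apply,
      real_inner_smul_left, map_smul, _root_.smul_apply, smul_eq_mul,
      ← Finset.mul_sum]
    ring

theorem exists_isOptimalTest {k : ℝ} (hk : 0 < k) (u : X hΩ T) : ∃ θ, IsOptimalTest k u θ := by
  obtain ⟨θ, hθ⟩ := (isCoercive_testInnerL (T := T) hk).exists_eq (beL k hΩ T u)
  exact ⟨θ.toY, fun v => hθ (WithLp.toLp 2 v)⟩

end Forms


/-! ### The conforming test function and the lower bound for the trial-to-test operator -/

section LowerBound

variable {d : ℕ} {Ω : Set (Space d)} {hΩ : IsOpen Ω} {T : Mesh Ω}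

/-- The elementwise Green formulas add up to a formula with piecewise derivatives. -/
theorem sum_green (v : brokenH1 T) (τ : brokenHdiv T) :
    ∑ j, normalTrace (T.elem j) (restrictHdiv T j τ) (trace (T.elem j) (restrictH1 T j v)) =
      ⟪τ.1.fst, v.1.snd⟫_ℝ + ⟪τ.1.snd, v.1.fst⟫_ℝ := by
  have h1 := sum_inner_restrictL2 T τ.1.fst v.1.snd
  have h2 := sum_inner_restrictL2 T τ.1.snd v.1.fst
  exact Finset.sum_add_distrib.trans (congrArg₂ (· + ·) h1 h2)

/-- Conforming vector fields have no normal jumps. -/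
theorem jumpNormal_inclusion_eq_zero (τ : Hdiv Ω) (w : skeletonHalf hΩ T) :
    jumpNormal (Submodule.inclusion (Hdiv_le_brokenHdiv hΩ T) τ) w = 0 := by
  obtain ⟨_, w, hw, rfl⟩ := w
  exact (sum_green (Submodule.inclusion (H1_le_brokenH1 hΩ T) w) _).trans
    (inner_add_inner_eq_zero_of_mem_H10 τ hw)

/-- Functions in `H¹₀(Ω)` have no jumps. -/
theorem jump_inclusion_eq_zero {w : H1 Ω} (hw : w ∈ H10 Ω) (q : skeletonMhalf hΩ T) :
    jump (Submodule.inclusion (H1_le_brokenH1 hΩ T) w) q = 0 := by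
  obtain ⟨_, q, rfl⟩ := q
  exact (sum_green _ (Submodule.inclusion (Hdiv_le_brokenHdiv hΩ T) q)).trans
    (inner_add_inner_eq_zero_of_mem_H10 q hw)

/-- The first order system `v / k + div τ = u`, `∇v + τ = k σ` has a solution
`v ∈ H¹₀(Ω)`, `τ ∈ H(div, Ω)`. -/
theorem exists_reaction_diffusion {k : ℝ} (hk : 0 < k) (u : L2 Ω) (σ : L2v Ω) :
    ∃ v ∈ H10 Ω, ∃ τ : Hdiv Ω,
      k⁻¹ • v.1.fst + τ.1.snd = u ∧ v.1.snd + τ.1.fst = k • σ := by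
  let P : H1 Ω →L[ℝ] L2 Ω := (WithLp.fstL 2 ℝ _ _).comp (H1 Ω).subtypeL
  let G : H1 Ω →L[ℝ] L2v Ω := (WithLp.sndL 2 ℝ _ _).comp (H1 Ω).subtypeL
  obtain ⟨v, hvS, hv⟩ := exists_reaction_diffusion_weak P G (Submodule.norm_sq_eq_of_prod _)
    (inv_pos.2 hk) (isClosed_H10 Ω) u (k • σ)
  have hdiv : HasWeakDiv Ω (k • σ - v.1.snd : L2v Ω) (u - k⁻¹ • v.1.fst : L2 Ω) := by
    refine HasWeakDiv.of_forall_H10 fun w hw => ?_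
    have h : k⁻¹ * ⟪v.1.fst, w.1.fst⟫_ℝ + ⟪v.1.snd, w.1.snd⟫_ℝ =
      ⟪u, w.1.fst⟫_ℝ + ⟪k • σ, w.1.snd⟫_ℝ := hv w hw
    rw [inner_sub_left, inner_sub_left, real_inner_smul_left v.1.fst]
    linarith
  exact ⟨v, hvS, ⟨WithLp.toLp 2 (k • σ - v.1.snd, u - k⁻¹ • v.1.fst), fun _ => hdiv⟩,
    add_sub_cancel _ _, add_sub_cancel _ _⟩

theorem be_eq_of_jump_eq_zero {k : ℝ} {u : X hΩ T} {v : Y T} (h1 : jumpNormal v.2 u.2.2.1 = 0)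
    (h2 : jump v.1 u.2.2.2 = 0) :
    be k u v = k⁻¹ * ⟪u.1, v.1.1.fst⟫_ℝ +
      (⟪u.1, v.2.1.snd⟫_ℝ + ⟪u.2.1, v.1.1.snd + v.2.1.fst⟫_ℝ) := by
  rw [be, b, h1, h2, sub_zero, sub_zero]

theorem be_conforming (k : ℝ) (u : X hΩ T) {v : H1 Ω} (hv : v ∈ H10 Ω) (τ : Hdiv Ω) :
    be k u (Submodule.inclusion (H1_le_brokenH1 hΩ T) v,
      Submodule.inclusion (Hdiv_le_brokenHdiv hΩ T) τ) =
      k⁻¹ * ⟪u.1, v.1.fst⟫_ℝ + (⟪u.1, τ.1.snd⟫_ℝ + ⟪u.2.1, v.1.snd + τ.1.fst⟫_ℝ) :=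
  be_eq_of_jump_eq_zero (jumpNormal_inclusion_eq_zero τ u.2.2.1)
    (jump_inclusion_eq_zero hv u.2.2.2)

theorem testInner_conforming (hΩ : IsOpen Ω) (T : Mesh Ω) (k : ℝ) (v : H1 Ω) (τ : Hdiv Ω) :
    testInner k
      (Submodule.inclusion (H1_le_brokenH1 hΩ T) v, Submodule.inclusion (Hdiv_le_brokenHdiv hΩ T) τ)
      (Submodule.inclusion (H1_le_brokenH1 hΩ T) v,
        Submodule.inclusion (Hdiv_le_brokenHdiv hΩ T) τ) =
      (k ^ 2)⁻¹ * ⟪v.1.fst, v.1.fst⟫_ℝ + k⁻¹ * ⟪v.1.snd, v.1.snd⟫_ℝ +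
        k⁻¹ * ⟪τ.1.fst, τ.1.fst⟫_ℝ + ⟪τ.1.snd, τ.1.snd⟫_ℝ :=
  rfl

/-- The conforming test function of `exists_reaction_diffusion` tests `u` with
`‖u‖² + k ‖σ‖²`, which is also its own squared norm: the mixed terms
`(v, div τ) + (∇v, τ)` cancel. -/
theorem exists_conforming_test {k : ℝ} (hk : 0 < k) (u : X hΩ T) :
    ∃ v : Y T, be k u v = ‖u.1‖ ^ 2 + k * ‖u.2.1‖ ^ 2 ∧
      testInner k v v = ‖u.1‖ ^ 2 + k * ‖u.2.1‖ ^ 2 := by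
  obtain ⟨v, hv, τ, h1, h2⟩ := exists_reaction_diffusion hk u.1 u.2.1
  obtain ⟨h3, h4⟩ := weighted_pythagoras hk h1 h2 (inner_add_inner_eq_zero_of_mem_H10 τ hv)
  exact ⟨_, (be_conforming k u hv τ).trans h3, (testInner_conforming hΩ T k v τ).trans h4⟩

/-- The lower bound for the trial-to-test operator. With the conforming test function `v`, it follows
from `2 (θ, v) ≤ (θ, θ) + (v, v)`, because `(θ, v)` and `(v, v)` coincide. -/
theorem le_testInner_of_isOptimalTest {k : ℝ} (hk : 0 < k) {u : X hΩ T} {θ : Y T}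
    (hθ : IsOptimalTest k u θ) : ‖u.1‖ ^ 2 + k * ‖u.2.1‖ ^ 2 ≤ testInner k θ θ := by
  obtain ⟨v, h1, h2⟩ := exists_conforming_test hk u
  have h3 : 2 * testInner k θ v ≤ testInner k θ θ + testInner k v v := by
    have e1 := mul_le_mul_of_nonneg_left (two_mul_inner_le θ.1.1.fst v.1.1.fst)
      (inv_nonneg.2 (sq_nonneg k))
    have e2 := mul_le_mul_of_nonneg_left (two_mul_inner_le θ.1.1.snd v.1.1.snd) (inv_nonneg.2 hk.le)
    have e3 := mul_le_mul_of_nonneg_left (two_mul_inner_le θ.2.1.fst v.2.1.fst) (inv_nonneg.2 hk.le)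
    have e4 := two_mul_inner_le θ.2.1.snd v.2.1.snd
    unfold testInner
    linarith
  rw [hθ v, h1, h2] at h3
  linarith

/-- Nondegeneracy of `be`: conforming test functions detect `u` and `σ`, and test functions
supported in a single element detect the trace components. -/
theorem beL_injective {k : ℝ} (hk : 0 < k) (hΩ : IsOpen Ω) (T : Mesh Ω) :
    Function.Injective (beL k hΩ T) := by
  rw [← LinearMap.ker_eq_bot, LinearMap.ker_eq_bot']
  intro u hu
  have hbe (v : Y T) : be k u v = 0 := DFunLike.congr_fun hu (WithLp.toLp 2 v)
  -- the value `‖u‖² + k ‖σ‖²` on the conforming test function is zero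
  obtain ⟨v, hv, -⟩ := exists_conforming_test hk u
  rw [hbe] at hv
  have hσ0 : 0 ≤ k * ‖u.2.1‖ ^ 2 := by positivity
  have hu1 : u.1 = 0 := by
    have : ‖u.1‖ ^ 2 = 0 := by linarith [sq_nonneg ‖u.1‖]
    simpa using this
  have hu2 : u.2.1 = 0 := by
    have : k * ‖u.2.1‖ ^ 2 = 0 := by linarith [sq_nonneg ‖u.1‖]
    simpa [hk.ne'] using this
  have hjump (v : Y T) : jumpNormal v.2 u.2.2.1 + jump v.1 u.2.2.2 = 0 := by
    have := hbe v
    rw [be, b, hu1, hu2] at this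
    simp only [inner_zero_left] at this
    linarith
  -- scalar test functions supported in one element
  have hu4 : u.2.2.2 = 0 := by
    refine Subtype.ext (funext fun j => ContinuousLinearMap.ext fun w => ?_)
    obtain ⟨w, rfl⟩ := trace_surjective _ w
    obtain ⟨v, hvj, hvi⟩ := exists_restrictH1_eq T j w
    have h := hjump (v, 0)
    simp only [jumpNormal, jump, map_zero, _root_.zero_apply, Finset.sum_const_zero,
      zero_add] at h
    rw [Finset.sum_eq_single j (fun i _ hi => by rw [hvi i hi, map_zero, map_zero])
      (by simp), hvj] at h
    exact h
  -- vector-valued test functions supported in one element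
  have hu3 : u.2.2.1 = 0 := by
    refine Subtype.ext (funext fun j => ?_)
    obtain ⟨w, hw⟩ := trace_surjective _ (u.2.2.1.1 j)
    rw [← hw]
    refine trace_eq_zero_iff.2 (mem_H10_of_forall_Hdiv fun q => ?_)
    obtain ⟨τ, hτj, hτi⟩ := exists_restrictHdiv_eq T j q
    have h := hjump (0, τ)
    simp only [jumpNormal, jump, map_zero, Finset.sum_const_zero, add_zero] at h
    rw [Finset.sum_eq_single j (fun i _ hi => by rw [hτi i hi, map_zero]; rfl) (by simp),
      hτj, ← hw, normalTrace_trace] at h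
    exact h
  exact Prod.ext hu1 (Prod.ext hu2 (Prod.ext hu3 hu4))

end LowerBound

/-! ### A single time step -/

section Step

variable {d : ℕ} {Ω : Set (Space d)} {hΩ : IsOpen Ω} {T : Mesh Ω}

theorem testInner_self (k : ℝ) (v : Y T) : testInner k v v =
    (k ^ 2)⁻¹ * ‖v.1.1.fst‖ ^ 2 + k⁻¹ * ‖v.1.1.snd‖ ^ 2 + k⁻¹ * ‖v.2.1.fst‖ ^ 2 +
      ‖v.2.1.snd‖ ^ 2 := by
  unfold testInner
  simp only [real_inner_self_eq_norm_sq]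

/-- Each time step is uniquely solvable. -/
theorem existsUnique_step {k : ℝ} (hk : 0 < k) (Xh : Submodule ℝ (X hΩ T))
    [FiniteDimensional ℝ Xh] (f u' : L2 Ω) :
    ∃! u, u ∈ Xh ∧ ∀ v ∈ optimalTestSpace k Xh, be k u v = Le k f u' v := by
  obtain ⟨u, ⟨hu, h⟩, huniq⟩ := (isCoercive_testInnerL (T := T) hk).existsUnique_optimalTest
    (beL k hΩ T) (beL_injective hk hΩ T) ((innerSL ℝ (f + k⁻¹ • u')).comp (valueL T)) Xh
  refine ⟨u, ⟨hu, ?_⟩, ?_⟩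
  · rintro θ ⟨w, hw, hθ⟩
    exact h (WithLp.toLp 2 θ) ⟨w, hw, fun v => hθ v.toY⟩
  · rintro u₁ ⟨hu₁, h₁⟩
    refine huniq u₁ ⟨hu₁, ?_⟩
    rintro θ ⟨w, hw, hθ⟩
    exact h₁ θ.toY ⟨w, hw, fun v => hθ (WithLp.toLp 2 v)⟩

/-- The stability estimate for one time step: test with the optimal test function of the discrete
solution. -/
theorem sqrt_le_of_step {k : ℝ} (hk : 0 < k) {Xh : Submodule ℝ (X hΩ T)} {f u' : L2 Ω}
    {u : X hΩ T} (hu : u ∈ Xh)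
    (h : ∀ v ∈ optimalTestSpace k Xh, be k u v = Le k f u' v) :
    Real.sqrt (‖u.1‖ ^ 2 + k * ‖u.2.1‖ ^ 2) ≤ ‖u'‖ + k * ‖f‖ := by
  obtain ⟨θ, hθ⟩ := exists_isOptimalTest hk u
  have h1 := le_testInner_of_isOptimalTest hk hθ
  have h2 : testInner k θ θ = ⟪f + k⁻¹ • u', θ.1.1.fst⟫_ℝ := (hθ θ).trans (h θ ⟨u, hu, hθ⟩)
  have h3 := real_inner_le_norm (f + k⁻¹ • u') θ.1.1.fst
  have h4 : ‖f + k⁻¹ • u'‖ ≤ ‖f‖ + k⁻¹ * ‖u'‖ := by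
    refine (norm_add_le _ _).trans (le_of_eq ?_)
    rw [norm_smul, Real.norm_of_nonneg (inv_nonneg.2 hk.le)]
  have h5 : (k⁻¹ * ‖θ.1.1.fst‖) ^ 2 ≤ testInner k θ θ := by
    rw [testInner_self, mul_pow, inv_pow, add_assoc, add_assoc]
    exact le_add_of_nonneg_right (by positivity)
  have ha := norm_nonneg θ.1.1.fst
  generalize testInner k θ θ = m at *
  generalize ‖θ.1.1.fst‖ = a at *
  have hm : 0 ≤ m := (sq_nonneg _).trans h5
  have h6 : k⁻¹ * a ≤ √m := Real.le_sqrt_of_sq_le h5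
  refine (Real.sqrt_le_sqrt h1).trans ?_
  have hR : 0 ≤ ‖u'‖ + k * ‖f‖ := by positivity
  have h7 : √m * √m ≤ (‖u'‖ + k * ‖f‖) * √m := by
    rw [Real.mul_self_sqrt hm]
    calc m ≤ (‖f‖ + k⁻¹ * ‖u'‖) * a := h2.trans_le (h3.trans (mul_le_mul_of_nonneg_right h4 ha))
      _ = (‖u'‖ + k * ‖f‖) * (k⁻¹ * a) := by field_simp; ring
      _ ≤ (‖u'‖ + k * ‖f‖) * √m := mul_le_mul_of_nonneg_left h6 hR
  rcases (Real.sqrt_nonneg m).eq_or_lt with h0 | h0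
  · rw [← h0]
    exact hR
  · exact le_of_mul_le_mul_right h7 h0

theorem norm_le_of_step {k : ℝ} (hk : 0 < k) (u : X hΩ T) :
    ‖u.1‖ ≤ Real.sqrt (‖u.1‖ ^ 2 + k * ‖u.2.1‖ ^ 2) :=
  Real.le_sqrt_of_sq_le (le_add_of_nonneg_right (by positivity))

end Step

/-! ### The time stepping -/

section Time

variable {d : ℕ} {Ω : Set (Space d)} {hΩ : IsOpen Ω} {N : ℕ} {T : Fin (N + 1) → Mesh Ω}

theorem step_pos {t : Fin (N + 1) → ℝ} (ht : StrictMono t) (n : Fin N) : 0 < step t n :=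
  sub_pos.2 (ht n.castSucc_lt_succ)

/-- The initial value is uniquely determined: it is the `L²` projection of `u0`. -/
theorem existsUnique_init {E : Type*} [NormedAddCommGroup E] [InnerProductSpace ℝ E]
    (S : Submodule ℝ E) [FiniteDimensional ℝ S] (u0 : E) :
    ∃! u, u ∈ S ∧ ∀ v ∈ S, ⟪u, v⟫_ℝ = ⟪u0, v⟫_ℝ := by
  refine ⟨S.starProjection u0, ⟨S.starProjection_apply_mem u0, fun v hv => ?_⟩, ?_⟩
  · exact S.inner_starProjection_left_eq_right u0 v |>.trans (by
      rw [S.starProjection_eq_self_iff.2 hv])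
  · rintro u ⟨hu, h⟩
    refine (S.eq_starProjection_of_mem_of_inner_eq_zero hu fun v hv => ?_).symm
    rw [inner_sub_left, h v hv, sub_self]

theorem norm_le_of_init {E : Type*} [NormedAddCommGroup E] [InnerProductSpace ℝ E]
    {S : Submodule ℝ E} {u u0 : E} (hu : u ∈ S) (h : ∀ v ∈ S, ⟪u, v⟫_ℝ = ⟪u0, v⟫_ℝ) :
    ‖u‖ ≤ ‖u0‖ := by
  have h1 := real_inner_le_norm u0 u
  rw [← h u hu, real_inner_self_eq_norm_sq, sq] at h1
  rcases (norm_nonneg u).eq_or_lt with h0 | h0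
  · rw [← h0]
    exact norm_nonneg _
  · exact le_of_mul_le_mul_right h1 h0

/-- An implicit recursion in which every step is uniquely solvable has exactly one solution. The
part `p n x` of the `n`-th state `x : F n` enters the following step. -/
theorem existsUnique_recursion {E : Type*} {N : ℕ} {F : Fin N → Type*} (p : ∀ n, F n → E)
    (R : ∀ n, E → F n → Prop) (hR : ∀ n e, ∃! x, R n e x) (e0 : E) :
    ∃! U : ∀ n, F n,
      ∀ n, R n (Fin.cons (α := fun _ => E) e0 (fun n => p n (U n)) n.castSucc) (U n) := by
  induction N generalizing e0 with
  | zero => exact ⟨fun n => n.elim0, fun n => n.elim0, fun _ _ => funext fun n => n.elim0⟩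
  | succ N ih =>
    have key (U : ∀ n, F n) :
        (∀ n, R n (Fin.cons (α := fun _ => E) e0 (fun n => p n (U n)) n.castSucc) (U n)) ↔
          R 0 e0 (U 0) ∧ ∀ n : Fin N, R n.succ (Fin.cons (α := fun _ => E) (p 0 (U 0))
            (fun n => p n.succ (U n.succ)) n.castSucc) (U n.succ) := by
      rw [Fin.forall_fin_succ]
      refine and_congr Iff.rfl (forall_congr' fun n => ?_)
      rw [← Fin.succ_castSucc, Fin.cons_succ]
      exact iff_of_eq (congrArg (R n.succ · (U n.succ))
        (congrFun (Fin.cons_self_tail fun n => p n (U n)) n.castSucc).symm)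
    obtain ⟨x, hx, hx'⟩ := hR 0 e0
    obtain ⟨V, hV, hV'⟩ := ih (fun n => p n.succ) (fun n => R n.succ) (fun n => hR n.succ) (p 0 x)
    refine ⟨Fin.cons x V, (key _).2 ⟨hx, hV⟩, fun U hU => ?_⟩
    obtain ⟨h0, h1⟩ := (key U).1 hU
    have e0 := hx' _ h0
    have e1 := hV' (fun n => U n.succ) (by rw [← e0]; exact h1)
    rw [← e0, ← e1]
    exact (Fin.cons_self_tail U).symm

theorem le_add_sum_of_step {N : ℕ} (a : Fin (N + 1) → ℝ) (c : Fin N → ℝ)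
    (h : ∀ n : Fin N, a n.succ ≤ a n.castSucc + c n) : a (Fin.last N) ≤ a 0 + ∑ n, c n := by
  induction N with
  | zero => simp
  | succ N ih =>
    have h1 := ih (fun n => a n.castSucc) (fun n => c n.castSucc) fun n => h n.castSucc
    have h2 := h (Fin.last N)
    rw [Fin.sum_univ_castSucc]
    rw [Fin.succ_last] at h2
    rw [Fin.castSucc_zero] at h1
    linarith

theorem castSucc_add_le_add_sum_of_step {N : ℕ} (a : Fin (N + 1) → ℝ) (c : Fin N → ℝ)
    (h : ∀ n : Fin N, a n.succ ≤ a n.castSucc + c n) {n : Fin N} (hn : (n : ℕ) + 1 = N) :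
    a n.castSucc + c n ≤ a 0 + ∑ j, c j := by
  cases N with
  | zero => exact n.elim0
  | succ N =>
    obtain rfl : n = Fin.last N := Fin.ext (Nat.succ_injective hn)
    have h1 := le_add_sum_of_step (fun n => a n.castSucc) (fun n => c n.castSucc)
      fun n => h n.castSucc
    rw [Fin.castSucc_zero] at h1
    rw [Fin.sum_univ_castSucc]
    linarith

theorem existsUnique_isDPGSolution {t : Fin (N + 1) → ℝ} (ht : StrictMono t) (f : ℝ → L2 Ω)
    (u0 : L2 Ω) (X0h : Submodule ℝ (L2 Ω)) [FiniteDimensional ℝ X0h]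
    (Xh : ∀ n : Fin N, Submodule ℝ (X hΩ (T n.succ))) [∀ n, FiniteDimensional ℝ (Xh n)] :
    ∃! p : L2 Ω × (∀ n : Fin N, X hΩ (T n.succ)), IsDPGSolution t f u0 X0h Xh p.1 p.2 := by
  obtain ⟨u0h, ⟨h1, h2⟩, h3⟩ := existsUnique_init X0h u0
  obtain ⟨U, hU, hU'⟩ := existsUnique_recursion (F := fun n : Fin N => X hΩ (T n.succ))
    (fun _ u => u.1)
    (fun n u' u => u ∈ Xh n ∧ ∀ v ∈ optimalTestSpace (step t n) (Xh n),
      be (step t n) u v = Le (step t n) (f (t n.succ)) u' v)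
    (fun n u' => existsUnique_step (step_pos ht n) (Xh n) (f (t n.succ)) u') u0h
  refine ⟨(u0h, U), ⟨h1, h2, fun n => (hU n).1, fun n => (hU n).2⟩, ?_⟩
  rintro ⟨w, W⟩ hW
  obtain rfl : w = u0h := h3 w ⟨hW.init_mem, hW.init⟩
  exact Prod.ext rfl (hU' W fun n => ⟨hW.mem n, hW.eq n⟩)

end Time

section Stability

variable {d : ℕ} {Ω : Set (Space d)} {hΩ : IsOpen Ω} {N : ℕ} {T : Fin (N + 1) → Mesh Ω}
  {t : Fin (N + 1) → ℝ} {f : ℝ → L2 Ω} {u0 u0h : L2 Ω} {X0h : Submodule ℝ (L2 Ω)}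
  {Xh : ∀ n : Fin N, Submodule ℝ (X hΩ (T n.succ))} {U : ∀ n : Fin N, X hΩ (T n.succ)}

theorem IsDPGSolution.sqrt_le (h : IsDPGSolution t f u0 X0h Xh u0h U) (ht : StrictMono t)
    (n : Fin N) : Real.sqrt (‖(U n).1‖ ^ 2 + step t n * ‖(U n).2.1‖ ^ 2) ≤
      ‖field u0h U n.castSucc‖ + step t n * ‖f (t n.succ)‖ :=
  sqrt_le_of_step (step_pos ht n) (h.mem n) (h.eq n)

theorem IsDPGSolution.norm_field_succ_le (h : IsDPGSolution t f u0 X0h Xh u0h U)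
    (ht : StrictMono t) (n : Fin N) :
    ‖field u0h U n.succ‖ ≤ ‖field u0h U n.castSucc‖ + step t n * ‖f (t n.succ)‖ :=
  (norm_le_of_step (step_pos ht n) (U n)).trans (h.sqrt_le ht n)

theorem IsDPGSolution.norm_field_castSucc_add_le (h : IsDPGSolution t f u0 X0h Xh u0h U)
    (ht : StrictMono t) {n : Fin N} (hn : (n : ℕ) + 1 = N) :
    ‖field u0h U n.castSucc‖ + step t n * ‖f (t n.succ)‖ ≤
      ‖u0‖ + ∑ j : Fin N, step t j * ‖f (t j.succ)‖ := by
  have h0 : ‖field u0h U 0‖ ≤ ‖u0‖ := norm_le_of_init h.init_mem h.init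
  have h1 := castSucc_add_le_add_sum_of_step (fun n => ‖field u0h U n‖)
    (fun n => step t n * ‖f (t n.succ)‖) (h.norm_field_succ_le ht) hn
  exact h1.trans (by gcongr)

end Stability

end DPG

theorem theorem2p3 {d : ℕ} (hd : d = 2 ∨ d = 3)
    (Ω : Set (DPG.Space d)) (hΩ : IsOpen Ω) (hΩb : Bornology.IsBounded Ω)
    (hΩs : SimplyConnectedSpace Ω) (hΩL : DPG.HasLipschitzBoundary Ω)
    (N : ℕ) (t : Fin (N + 1) → ℝ) (ht0 : t 0 = 0) (ht : StrictMono t)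
    (T : Fin (N + 1) → DPG.Mesh Ω)
    (X0h : Submodule ℝ (DPG.L2 Ω)) (hX0h : FiniteDimensional ℝ X0h)
    (Xh : ∀ n : Fin N, Submodule ℝ (DPG.X hΩ (T n.succ)))
    (hXh : ∀ n, FiniteDimensional ℝ (Xh n))
    (u0 : DPG.L2 Ω) (f : ℝ → DPG.L2 Ω) :
    -- unique solvability
    (∃! p : DPG.L2 Ω × (∀ n : Fin N, DPG.X hΩ (T n.succ)),
      DPG.IsDPGSolution t f u0 X0h Xh p.1 p.2) ∧
    -- stability of the solution
    ∀ (u0h : DPG.L2 Ω) (U : ∀ n : Fin N, DPG.X hΩ (T n.succ)),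
      DPG.IsDPGSolution t f u0 X0h Xh u0h U →
      (∀ n : Fin N,
        Real.sqrt (‖(U n).1‖ ^ 2 + DPG.step t n * ‖(U n).2.1‖ ^ 2) ≤
          ‖DPG.field u0h U n.castSucc‖ + DPG.step t n * ‖f (t n.succ)‖) ∧
      (∀ n : Fin N, (n : ℕ) + 1 = N →
        Real.sqrt (‖(U n).1‖ ^ 2 + DPG.step t n * ‖(U n).2.1‖ ^ 2) ≤
          ‖u0‖ + ∑ j : Fin N, DPG.step t j * ‖f (t j.succ)‖) := by
  refine ⟨DPG.existsUnique_isDPGSolution ht f u0 X0h Xh, fun u0h U hU => ⟨hU.sqrt_le ht,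
    fun n hn => (hU.sqrt_le ht n).trans (hU.norm_field_castSucc_add_le ht hn)⟩⟩
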